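/- Let $\mathbb F=\mathbb R$ or $\mathbb F=\mathbb C$ and $d\in\mathbb N_0$. Let $P_0\in\mathbb F^{d\times d}$, and let $P_1\in\mathbb F^{d\times d}$ be Hermitian and invertible. Let $n_1$ and $n_2=d-n_1$ be the numbers of positive and of negative eigenvalues of $P_1$, counted with multiplicity, and fix a decomposition $$P_1=S^{-1}\begin{bmatrix}\Lambda&0\\0&\Theta\end{bmatrix}S$$ with $S\in\mathbb F^{d\times d}$ unitary, $\Lambda\in\mathbb R^{n_1\times n_1}$ diagonal and positive definite, and $\Theta\in\mathbb R^{n_2\times n_2}$ diagonal and negative definite. Let $\mathcal H:[0,\infty)\to\mathbb F^{d\times d}$ be such that $\mathcal H(\zeta)$ is (Hermitian) positive definite for a.e. $\zeta$ and $\mathcal H,\mathcal H^{-1}\in L^\infty([0,\infty);\mathbb F^{d\times d})$. Let $\hat W_B\in\mathbb F^{k\times d}$ have full row rank $k$, where $0\le k\le\min\{n_1,n_2\}$. On $X=L^2([0,\infty);\mathbb F^d)$, with standard scalar product $\langle\cdot,\cdot\rangle$, define the operators $$Ax=P_0x+P_1x',\qquad D(A)=\{x\in \mathcal W^{1,2}([0,\infty);\mathbb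 F^d)\mid \hat W_Bx(0)=0\},$$ and $A\mathcal H:x\mapsto A(\mathcal Hx)$ with $D(A\mathcal H)=\{x\in X\mid \mathcal Hx\in D(A)\}$; here $x'$ is the weak derivative, and $x(0)$ is the value at $0$ of the continuous representative of $x$. Write $\Re P=\tfrac12(P+P^*)$ for a square matrix $P$. Theorem. The following statements are equivalent: 1. $A\mathcal H$ generates a unitary $C_0$-group on $X$ equipped with the scalar product $\langle\cdot,\mathcal H\,\cdot\rangle$; 2. $\Re\langle Ax,x\rangle=0$ for every $x\in D(A)$; 3. $\Re P_0=0$, and $y^*P_1y=0$ for every $y\in\ker\hat W_B$; 4. $k=n_1=n_2$, $\Re P_0=0$, and $\hat W_B=\begin{bmatrix}U_1&U_2\end{bmatrix}S$ for some invertible $U_1,U_2\in\mathbb F^{n_1\times n_1}$ with $\Lambda+U_1^*U_2^{-*}\Theta U_2^{-1}U_1=0$. -/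

import Mathlib

open MeasureTheory Set Filter Topology
open scoped Matrix ContDiff

noncomputable section

namespace PortHamiltonian

/-- Lebesgue measure on the half-line `[0, ∞)`. -/
abbrev halfLine : Measure ℝ := volume.restrict (Ici (0 : ℝ))

/-- The state space `X = L²([0, ∞); 𝕜ᵈ)`, with its standard scalar product (`𝕜 = ℝ` or `ℂ`). -/
abbrev State (𝕜 : Type*) [RCLike 𝕜] (d : ℕ) : Type _ :=
  Lp (EuclideanSpace 𝕜 (Fin d)) 2 halfLine

/-- A matrix acting on a Euclidean vector. -/
def act {𝕜 : Type*} [RCLike 𝕜] {m d : ℕ} (M : Matrix (Fin m) (Fin d) 𝕜)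
    (v : EuclideanSpace 𝕜 (Fin d)) : EuclideanSpace 𝕜 (Fin m) :=
  WithLp.toLp 2 (M *ᵥ WithLp.ofLp v)

/-- `g` is the weak derivative of `f` on the open half-line `(0, ∞)`: one has
`∫ φ' f = - ∫ φ g` for all test functions `φ ∈ C_c^∞((0, ∞))`. As `f` and `g` range over `L²`,
the existence of such a `g` says that `f` belongs to the Sobolev space `W^{1,2}([0, ∞); 𝕜ᵈ)`. -/
def IsWeakDeriv {𝕜 : Type*} [RCLike 𝕜] {d : ℕ} (f g : State 𝕜 d) : Prop :=
  ∀ φ : ℝ → ℝ, ContDiff ℝ ∞ φ → HasCompactSupport φ → tsupport φ ⊆ Ioi 0 →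
    ∫ ζ, deriv φ ζ • f ζ ∂halfLine = - ∫ ζ, φ ζ • g ζ ∂halfLine

/-- `v` is the boundary value `f(0)`, i.e. the value at `0` of the representative of `f` that is
continuous on `[0, ∞)` (each element of `W^{1,2}` has exactly one). -/
def HasBoundaryValue {𝕜 : Type*} [RCLike 𝕜] {d : ℕ} (f : State 𝕜 d)
    (v : EuclideanSpace 𝕜 (Fin d)) : Prop :=
  ∃ u : ℝ → EuclideanSpace 𝕜 (Fin d),
    ContinuousOn u (Ici 0) ∧ (∀ᵐ ζ ∂halfLine, f ζ = u ζ) ∧ u 0 = v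

/-- The graph of the operator `A x = P₀ x + P₁ x'` with domain
`D(A) = {x ∈ W^{1,2}([0, ∞); 𝕜ᵈ) | W x(0) = 0}`:
`GraphA P₀ P₁ W x y` says that `x ∈ D(A)` and `A x = y`. -/
def GraphA {𝕜 : Type*} [RCLike 𝕜] {d k : ℕ} (P₀ P₁ : Matrix (Fin d) (Fin d) 𝕜)
    (W : Matrix (Fin k) (Fin d) 𝕜) (x y : State 𝕜 d) : Prop :=
  ∃ (x' : State 𝕜 d) (v : EuclideanSpace 𝕜 (Fin d)),
    IsWeakDeriv x x' ∧ HasBoundaryValue x v ∧ act W v = 0 ∧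
      ∀ᵐ ζ ∂halfLine, y ζ = act P₀ (x ζ) + act P₁ (x' ζ)

/-- The graph of `Aℋ`, with domain `D(Aℋ) = {x ∈ X | ℋx ∈ D(A)}`:
`GraphAH P₀ P₁ W ℋ x y` says that `x ∈ D(Aℋ)` and `A(ℋx) = y`. -/
def GraphAH {𝕜 : Type*} [RCLike 𝕜] {d k : ℕ} (P₀ P₁ : Matrix (Fin d) (Fin d) 𝕜)
    (W : Matrix (Fin k) (Fin d) 𝕜) (ℋ : ℝ → Matrix (Fin d) (Fin d) 𝕜) (x y : State 𝕜 d) : Prop :=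
  ∃ z : State 𝕜 d, (∀ᵐ ζ ∂halfLine, z ζ = act (ℋ ζ) (x ζ)) ∧ GraphA P₀ P₁ W z y

/-- Weak derivatives are unique, so that the graphs above are graphs of (single-valued)
operators. -/
theorem IsWeakDeriv.unique {𝕜 : Type*} [RCLike 𝕜] {d : ℕ} {f g h : State 𝕜 d}
    (hg : IsWeakDeriv f g) (hh : IsWeakDeriv f h) : g = h := by
  have key : ∀ᵐ ζ ∂halfLine, ζ ∈ Ioi (0 : ℝ) → (g - h : State 𝕜 d) ζ = 0 := by
    refine isOpen_Ioi.ae_eq_zero_of_integral_contDiff_smul_eq_zero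
      (((Lp.memLp (g - h)).locallyIntegrable (by norm_num)).locallyIntegrableOn _) ?_
    intro φ hφ hc hs
    have hint : ∀ w : State 𝕜 d, Integrable (fun ζ => φ ζ • w ζ) halfLine := fun w =>
      ((Lp.memLp w).locallyIntegrable (by norm_num)).integrable_smul_left_of_hasCompactSupport
        hφ.continuous hc
    have h1 := hg φ hφ hc hs
    rw [hh φ hφ hc hs, neg_inj] at h1
    calc ∫ ζ, φ ζ • (g - h : State 𝕜 d) ζ ∂halfLine
        = ∫ ζ, (φ ζ • g ζ - φ ζ • h ζ) ∂halfLine := by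
          apply integral_congr_ae
          filter_upwards [Lp.coeFn_sub g h] with ζ hζ
          rw [hζ, Pi.sub_apply, smul_sub]
      _ = 0 := by rw [integral_sub (hint g) (hint h), h1, sub_self]
  have hmem : ∀ᵐ ζ ∂halfLine, ζ ∈ Ioi (0 : ℝ) := by
    rw [halfLine, ← restrict_Ioi_eq_restrict_Ici]
    exact ae_restrict_mem measurableSet_Ioi
  rw [← sub_eq_zero]
  apply Lp.ext
  filter_upwards [key, hmem, Lp.coeFn_zero (EuclideanSpace 𝕜 (Fin d)) 2 halfLine]
    with ζ h1 h2 h3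
  rw [h1 h2, h3, Pi.zero_apply]

theorem GraphA.unique {𝕜 : Type*} [RCLike 𝕜] {d k : ℕ} {P₀ P₁ : Matrix (Fin d) (Fin d) 𝕜}
    {W : Matrix (Fin k) (Fin d) 𝕜} {x y z : State 𝕜 d}
    (hy : GraphA P₀ P₁ W x y) (hz : GraphA P₀ P₁ W x z) : y = z := by
  obtain ⟨a, v, ha, -, -, hya⟩ := hy
  obtain ⟨b, w, hb, -, -, hzb⟩ := hz
  obtain rfl := ha.unique hb
  apply Lp.ext
  filter_upwards [hya, hzb] with ζ h1 h2
  rw [h1, h2]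

theorem GraphAH.unique {𝕜 : Type*} [RCLike 𝕜] {d k : ℕ} {P₀ P₁ : Matrix (Fin d) (Fin d) 𝕜}
    {W : Matrix (Fin k) (Fin d) 𝕜} {ℋ : ℝ → Matrix (Fin d) (Fin d) 𝕜} {x y z : State 𝕜 d}
    (hy : GraphAH P₀ P₁ W ℋ x y) (hz : GraphAH P₀ P₁ W ℋ x z) : y = z := by
  obtain ⟨a, ha, hya⟩ := hy
  obtain ⟨b, hb, hzb⟩ := hz
  have hab : a = b := by
    apply Lp.ext
    filter_upwards [ha, hb] with ζ h1 h2
    rw [h1, h2]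
  subst hab
  exact hya.unique hzb

/-- The scalar product `⟨x, ℋ y⟩ = ∫ ⟨x(ζ), ℋ(ζ) y(ζ)⟩ dζ` on `X`. -/
def energyInner {𝕜 : Type*} [RCLike 𝕜] {d : ℕ} (ℋ : ℝ → Matrix (Fin d) (Fin d) 𝕜)
    (x y : State 𝕜 d) : 𝕜 :=
  ∫ ζ, inner 𝕜 (x ζ) (act (ℋ ζ) (y ζ)) ∂halfLine

/-- The norm of the scalar product `⟨·, ℋ ·⟩` on `X`. -/
def energyNorm {𝕜 : Type*} [RCLike 𝕜] {d : ℕ} (ℋ : ℝ → Matrix (Fin d) (Fin d) 𝕜)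
    (x : State 𝕜 d) : ℝ :=
  Real.sqrt (RCLike.re (energyInner ℋ x x))

/-- `T` is a unitary `C₀`-group on `(X, ⟨·, ℋ ·⟩)`: a strongly continuous one-parameter group of
linear operators that preserve the scalar product. (Each `T t` is bijective with inverse
`T (-t)`, hence unitary, in particular bounded; by the group law and unitarity, strong continuity
at `0` is strong continuity everywhere.) -/
structure IsUnitaryC0Group {𝕜 : Type*} [RCLike 𝕜] {d : ℕ} (ℋ : ℝ → Matrix (Fin d) (Fin d) 𝕜)
    (T : ℝ → State 𝕜 d →ₗ[𝕜] State 𝕜 d) : Prop where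
  map_zero : ∀ x, T 0 x = x
  map_add : ∀ s t x, T (s + t) x = T s (T t x)
  strong_cont : ∀ x, Tendsto (fun t => energyNorm ℋ (T t x - x)) (𝓝 0) (𝓝 0)
  unitary : ∀ t x y, energyInner ℋ (T t x) (T t y) = energyInner ℋ x y

/-- The operator with graph `G` generates a unitary `C₀`-group on `(X, ⟨·, ℋ ·⟩)`: there is such a
group `T` for which `x` lies in the domain and is mapped to `y` exactly if
`(T(t) x - x) / t → y` as `t → 0`. -/
def GeneratesUnitaryGroup {𝕜 : Type*} [RCLike 𝕜] {d : ℕ} (ℋ : ℝ → Matrix (Fin d) (Fin d) 𝕜)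
    (G : State 𝕜 d → State 𝕜 d → Prop) : Prop :=
  ∃ T : ℝ → State 𝕜 d →ₗ[𝕜] State 𝕜 d, IsUnitaryC0Group ℋ T ∧
    ∀ x y, G x y ↔
      Tendsto (fun t : ℝ => energyNorm ℋ (((t⁻¹ : ℝ) : 𝕜) • (T t x - x) - y)) (𝓝[≠] 0) (𝓝 0)

/-- `Re P = (P + P*) / 2`. -/
def rePart {𝕜 : Type*} [RCLike 𝕜] {d : ℕ} (P : Matrix (Fin d) (Fin d) 𝕜) :
    Matrix (Fin d) (Fin d) 𝕜 :=
  (2⁻¹ : 𝕜) • (P + Pᴴ)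

/-- The number of positive eigenvalues of a Hermitian matrix, counted with multiplicity. -/
def numPosEigenvalues {𝕜 : Type*} [RCLike 𝕜] {d : ℕ} {P : Matrix (Fin d) (Fin d) 𝕜}
    (hP : P.IsHermitian) : ℕ :=
  Nat.card {i : Fin d // 0 < hP.eigenvalues i}

/-- The number of negative eigenvalues of a Hermitian matrix, counted with multiplicity. -/
def numNegEigenvalues {𝕜 : Type*} [RCLike 𝕜] {d : ℕ} {P : Matrix (Fin d) (Fin d) 𝕜}
    (hP : P.IsHermitian) : ℕ :=
  Nat.card {i : Fin d // hP.eigenvalues i < 0}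

/-- The diagonal matrix over `𝕜` with the given real entries. -/
def realDiag (𝕜 : Type*) [RCLike 𝕜] {n : ℕ} (a : Fin n → ℝ) : Matrix (Fin n) (Fin n) 𝕜 :=
  Matrix.diagonal fun i => (a i : 𝕜)

/-- `P = S⁻¹ Δ S` with `Δ = diag(Λ, Θ)`, where `Λ = diag(l)` is positive definite, `Θ = diag(θ)`
is negative definite, and `S` is unitary, so that `S⁻¹ = S*`. The rows of `S` are
indexed by the two blocks of `Δ`. -/
structure IsDiagonalization {𝕜 : Type*} [RCLike 𝕜] {d n₁ n₂ : ℕ} (P : Matrix (Fin d) (Fin d) 𝕜)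
    (S : Matrix (Fin n₁ ⊕ Fin n₂) (Fin d) 𝕜) (l : Fin n₁ → ℝ) (θ : Fin n₂ → ℝ) : Prop where
  star_mul_self : Sᴴ * S = 1
  mul_star_self : S * Sᴴ = 1
  pos : ∀ i, 0 < l i
  neg : ∀ i, θ i < 0
  eq : P = Sᴴ * Matrix.fromBlocks (realDiag 𝕜 l) 0 0 (realDiag 𝕜 θ) * S

end PortHamiltonian

end

/-! Integration by parts gives `⟨Au, x⟩ + ⟨u, Ax⟩ = ⟨(P₀ + P₀ᴴ)u, x⟩ - ⟨u(0), P₁ x(0)⟩`, with no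
contribution from infinity (`inner_add_inner_eq_boundary`). So only `P₀ + P₀ᴴ` and the form of `P₁`
on `ker W` matter. Test functions isolate the former and the functions `e^{-ζ} v` the latter, which
yields 2 → 3.

For 3 → 4, an isotropic subspace meets each definite eigenspace of `P₁` trivially, so `d - k ≤ min
n₁ n₂`. Together with `k ≤ min n₁ n₂` this forces `k = n₁ = n₂`. Then `ker W` is the graph of
`-U₂⁻¹U₁` between the two eigenspaces, and isotropy of this graph is the stated matrix identity
(`dims_eq`, `exists_blocks`).

For 4 → 1, invertibility of `U₂⁻¹U₁` makes `ker W` equal to its own orthogonal complement for the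
form of `P₁` (`mulVec_eq_zero_iff_forall`), and therefore `A` is skew-adjoint (`graphA_iff_forall`).
Then `Aℋ` is skew-adjoint for `⟨·, ℋ·⟩`, and Stone's theorem applies
(`IsSkewAdjoint.exists_unitary_group`). It is proved by Yosida approximation, which treats the real
and complex cases alike.

For 1 → 2, differentiate the conserved product `⟨T(t)x, ℋT(t)x⟩` at `t = 0`. -/

noncomputable section

namespace PortHamiltonian

/-! ### Groups generated by bounded skew operators -/

section Exponential

variable {𝕜 E : Type*} [RCLike 𝕜] [NormedAddCommGroup E] [InnerProductSpace 𝕜 E]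

/-- A bounded operator is skew-symmetric. -/
def IsSkewSymm (B : E →L[𝕜] E) : Prop :=
  ∀ x y, inner 𝕜 (B x) y + inner 𝕜 x (B y) = 0

/-- The group generated by a bounded operator. -/
def expGroup (B : E →L[𝕜] E) (t : ℝ) : E →L[𝕜] E :=
  NormedSpace.exp ((t : 𝕜) • B)

theorem expGroup_zero (B : E →L[𝕜] E) : expGroup B 0 = 1 := by
  simp [expGroup]

variable [CompleteSpace E]

theorem expGroup_add (B : E →L[𝕜] E) (s t : ℝ) :
    expGroup B (s + t) = expGroup B s * expGroup B t := by
  let _ : NormedAlgebra ℚ (E →L[𝕜] E) := NormedAlgebra.restrictScalars ℚ 𝕜 _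
  rw [expGroup, expGroup, expGroup, ← NormedSpace.exp_add_of_commute, ← add_smul,
    RCLike.ofReal_add]
  exact ((Commute.refl B).smul_left _).smul_right _

/-- Reduces the distance between two commuting groups to the distance of a single group from the
identity. -/
theorem expGroup_sub_mul {B C : E →L[𝕜] E} (h : Commute B C) (t : ℝ) :
    expGroup B t = expGroup C t * expGroup (B - C) t := by
  let _ : NormedAlgebra ℚ (E →L[𝕜] E) := NormedAlgebra.restrictScalars ℚ 𝕜 _
  rw [expGroup, expGroup, expGroup, ← NormedSpace.exp_add_of_commute, ← smul_add,
    add_sub_cancel]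
  exact (((h.symm.sub_right (Commute.refl C))).smul_left _).smul_right _

theorem IsSkewSymm.star_eq {B : E →L[𝕜] E} (hB : IsSkewSymm B) : star B = -B := by
  rw [ContinuousLinearMap.star_eq_adjoint]
  symm
  rw [ContinuousLinearMap.eq_adjoint_iff]
  intro u v
  rw [neg_apply, inner_neg_left]
  linear_combination -hB u v

theorem IsSkewSymm.expGroup_mem_unitary {B : E →L[𝕜] E} (hB : IsSkewSymm B) (t : ℝ) :
    expGroup B t ∈ unitary (E →L[𝕜] E) := by
  let _ : NormedAlgebra ℚ (E →L[𝕜] E) := NormedAlgebra.restrictScalars ℚ 𝕜 _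
  have hmem : (t : 𝕜) • B ∈ skewAdjoint (E →L[𝕜] E) := by
    rw [skewAdjoint.mem_iff, star_smul, hB.star_eq, RCLike.star_def, RCLike.conj_ofReal, smul_neg]
  exact NormedSpace.exp_mem_unitary_of_mem_skewAdjoint hmem

theorem IsSkewSymm.inner_expGroup {B : E →L[𝕜] E} (hB : IsSkewSymm B) (t : ℝ) (x y : E) :
    inner 𝕜 (expGroup B t x) (expGroup B t y) = inner 𝕜 x y :=
  ContinuousLinearMap.inner_map_map_of_mem_unitary (hB.expGroup_mem_unitary t) x y

theorem IsSkewSymm.norm_expGroup {B : E →L[𝕜] E} (hB : IsSkewSymm B) (t : ℝ) (x : E) :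
    ‖expGroup B t x‖ = ‖x‖ := by
  rw [@norm_eq_sqrt_re_inner 𝕜, hB.inner_expGroup, ← @norm_eq_sqrt_re_inner 𝕜]

variable [NormedSpace ℝ E] [IsScalarTower ℝ 𝕜 E]

theorem hasDerivAt_expGroup (B : E →L[𝕜] E) (x : E) (t : ℝ) :
    HasDerivAt (fun s => expGroup B s x) (expGroup B t (B x)) t := by
  have h1 := ((ContinuousLinearMap.apply 𝕜 E x).hasFDerivAt.comp_hasDerivAt _
    (hasDerivAt_exp_smul_const B (t : 𝕜)))
  have h2 : HasDerivAt (fun s : ℝ => (s : 𝕜)) 1 t := by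
    simpa using (RCLike.ofRealCLM (K := 𝕜)).hasDerivAt (x := t)
  simpa [Function.comp_def, expGroup] using h1.scomp t h2

/-- Mean value inequality for `s ↦ e^{sB}x - s z`, whose derivative is `e^{sB}(Bx - z) + (e^{sB}z -
z)`. The vector `z` is left free because it will be the limit of `B n x` along a sequence of
generators. -/
theorem IsSkewSymm.norm_expGroup_sub_sub_le {B : E →L[𝕜] E} (hB : IsSkewSymm B) (x z : E) (t : ℝ)
    {ε : ℝ} (hε : ∀ s, |s| ≤ |t| → ‖expGroup B s z - z‖ ≤ ε) :
    ‖expGroup B t x - x - t • z‖ ≤ (‖B x - z‖ + ε) * |t| := by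
  have hd : ∀ s ∈ uIcc 0 t, HasDerivWithinAt (fun s => expGroup B s x - s • z)
      (expGroup B s (B x) - (1 : ℝ) • z) (uIcc 0 t) s := fun s _ =>
    ((hasDerivAt_expGroup B x s).sub ((hasDerivAt_id s).smul_const z)).hasDerivWithinAt
  have hb : ∀ s ∈ uIcc 0 t, ‖expGroup B s (B x) - (1 : ℝ) • z‖ ≤ ‖B x - z‖ + ε := by
    intro s hs
    have hst : |s| ≤ |t| := by
      simpa using abs_sub_left_of_mem_uIcc hs
    calc ‖expGroup B s (B x) - (1 : ℝ) • z‖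
        = ‖expGroup B s (B x - z) + (expGroup B s z - z)‖ := by
          rw [map_sub, one_smul, sub_add_sub_cancel]
      _ ≤ ‖B x - z‖ + ε := by
          refine (norm_add_le _ _).trans (add_le_add ?_ (hε s hst))
          rw [hB.norm_expGroup]
  have h := Convex.norm_image_sub_le_of_norm_hasDerivWithin_le hd hb (convex_uIcc 0 t)
    left_mem_uIcc right_mem_uIcc
  simpa [expGroup_zero, sub_right_comm] using h

theorem IsSkewSymm.norm_expGroup_sub_le {B : E →L[𝕜] E} (hB : IsSkewSymm B) (x : E) (t : ℝ) :
    ‖expGroup B t x - x‖ ≤ ‖B x‖ * |t| := by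
  simpa using hB.norm_expGroup_sub_sub_le x 0 t (ε := 0) (by simp)

end Exponential

/-! ### Skew-adjoint relations and their resolvents -/

section SkewAdjoint

variable {𝕜 E : Type*} [RCLike 𝕜] [NormedAddCommGroup E] [InnerProductSpace 𝕜 E]

/-- A linear relation on `E` is skew-adjoint. -/
def IsSkewAdjoint (G : Submodule 𝕜 (E × E)) : Prop :=
  ∀ p, p ∈ G ↔ ∀ q ∈ G, inner 𝕜 q.2 p.1 + inner 𝕜 q.1 p.2 = 0

variable {G : Submodule 𝕜 (E × E)}

theorem IsSkewAdjoint.isClosed (hG : IsSkewAdjoint G) : IsClosed (G : Set (E × E)) := by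
  have h : (G : Set (E × E)) =
      ⋂ q ∈ G, {p : E × E | inner 𝕜 q.2 p.1 + inner 𝕜 q.1 p.2 = 0} := by
    ext p
    simpa using hG p
  rw [h]
  exact isClosed_biInter fun q _ => isClosed_eq (by fun_prop) continuous_const

theorem IsSkewAdjoint.re_inner_eq_zero (hG : IsSkewAdjoint G) {p : E × E} (hp : p ∈ G) :
    RCLike.re (inner 𝕜 p.1 p.2) = 0 := by
  have h := congrArg RCLike.re ((hG p).1 hp p hp)
  rw [map_add, inner_re_symm, map_zero] at h
  linarith

/-- The cross term is a multiple of `Re ⟨p.1, p.2⟩ = 0`. The identity bounds both components of `p`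
by `r p.1 - p.2`, for either sign of `r ≠ 0`. -/
theorem IsSkewAdjoint.norm_smul_sub_sq (hG : IsSkewAdjoint G) {p : E × E} (hp : p ∈ G) (r : ℝ) :
    ‖(r : 𝕜) • p.1 - p.2‖ ^ 2 = r ^ 2 * ‖p.1‖ ^ 2 + ‖p.2‖ ^ 2 := by
  rw [@norm_sub_sq 𝕜, inner_smul_left, RCLike.conj_ofReal, RCLike.re_ofReal_mul,
    hG.re_inner_eq_zero hp, norm_smul, RCLike.norm_ofReal, mul_pow, sq_abs]
  ring

theorem IsSkewAdjoint.norm_fst_le (hG : IsSkewAdjoint G) {p : E × E} (hp : p ∈ G) {r : ℝ}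
    (hr : r ≠ 0) : ‖p.1‖ ≤ |r|⁻¹ * ‖(r : 𝕜) • p.1 - p.2‖ := by
  rw [inv_mul_eq_div, le_div_iff₀ (abs_pos.2 hr)]
  refine abs_le_of_sq_le_sq' ?_ (norm_nonneg _) |>.2
  rw [hG.norm_smul_sub_sq hp, mul_pow, sq_abs]
  nlinarith [sq_nonneg ‖p.2‖]

theorem IsSkewAdjoint.norm_snd_le (hG : IsSkewAdjoint G) {p : E × E} (hp : p ∈ G) (r : ℝ) :
    ‖p.2‖ ≤ ‖(r : 𝕜) • p.1 - p.2‖ := by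
  refine abs_le_of_sq_le_sq' ?_ (norm_nonneg _) |>.2
  rw [hG.norm_smul_sub_sq hp]
  nlinarith [mul_nonneg (sq_nonneg r) (sq_nonneg ‖p.1‖)]

/-- The map `(x, y) ↦ r x - y`. -/
def smulSub (𝕜 E : Type*) [RCLike 𝕜] [NormedAddCommGroup E] [InnerProductSpace 𝕜 E] (r : ℝ) :
    E × E →L[𝕜] E :=
  (r : 𝕜) • ContinuousLinearMap.fst 𝕜 E E - ContinuousLinearMap.snd 𝕜 E E

theorem smulSub_apply (r : ℝ) (p : E × E) : smulSub 𝕜 E r p = (r : 𝕜) • p.1 - p.2 := rfl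

/-- A vector `w` orthogonal to the range of `r - A` satisfies `(w, -r w) ∈ G` by maximality of `G`,
and then `r ‖w‖² = 0`. -/
theorem IsSkewAdjoint.eq_zero_of_inner_smulSub (hG : IsSkewAdjoint G) {r : ℝ} (hr : r ≠ 0) {w : E}
    (hw : ∀ p ∈ G, inner 𝕜 (smulSub 𝕜 E r p) w = 0) : w = 0 := by
  have hmem : ((w, -((r : 𝕜) • w)) : E × E) ∈ G := by
    rw [hG]
    intro q hq
    have h := hw q hq
    rw [smulSub_apply, inner_sub_left, inner_smul_left, RCLike.conj_ofReal] at h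
    simp only [inner_neg_right, inner_smul_right]
    linear_combination -h
  have h := hG.re_inner_eq_zero hmem
  simp only [inner_neg_right, inner_smul_right, map_neg, RCLike.re_ofReal_mul,
    inner_self_eq_norm_sq, neg_eq_zero, mul_eq_zero, hr, false_or] at h
  simpa using h

theorem IsSkewAdjoint.eq_of_smulSub_eq (hG : IsSkewAdjoint G) {r : ℝ} (hr : r ≠ 0) {p q : E × E}
    (hp : p ∈ G) (hq : q ∈ G) (h : smulSub 𝕜 E r p = smulSub 𝕜 E r q) : p = q := by
  have hpq := G.sub_mem hp hq
  have h0 : (r : 𝕜) • (p - q).1 - (p - q).2 = 0 := by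
    rw [← smulSub_apply, map_sub, h, sub_self]
  have h1 := hG.norm_fst_le hpq hr
  have h2 := hG.norm_snd_le hpq r
  rw [h0, norm_zero] at h2
  rw [h0, norm_zero, mul_zero] at h1
  rw [← sub_eq_zero]
  exact Prod.ext (norm_le_zero_iff.1 h1) (norm_le_zero_iff.1 h2)

/-- `R` is the resolvent `(r - A)⁻¹` of the operator with graph `G`, and `‖R‖ ≤ |r|⁻¹`. -/
structure IsResolvent (G : Submodule 𝕜 (E × E)) (r : ℝ) (R : E →L[𝕜] E) : Prop where
  mem : ∀ f, (R f, (r : 𝕜) • R f - f) ∈ G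
  apply_smul_sub : ∀ p ∈ G, R ((r : 𝕜) • p.1 - p.2) = p.1
  norm_le : ∀ f, ‖R f‖ ≤ |r|⁻¹ * ‖f‖

variable [CompleteSpace E]

/-- The norm identity makes `r - A` bounded below on the complete graph, so its range is closed; it
is also dense, since its orthogonal complement vanishes. -/
theorem IsSkewAdjoint.exists_smulSub_eq (hG : IsSkewAdjoint G) {r : ℝ} (hr : r ≠ 0) (f : E) :
    ∃ p ∈ G, smulSub 𝕜 E r p = f := by
  have : CompleteSpace G := hG.isClosed.completeSpace_coe
  set L : G →L[𝕜] E := (smulSub 𝕜 E r).comp G.subtypeL with hL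
  have hanti : AntilipschitzWith (max |r|⁻¹ 1).toNNReal L := by
    refine ContinuousLinearMap.antilipschitz_of_bound L fun p => ?_
    rw [Real.coe_toNNReal _ (le_max_of_le_right zero_le_one), Submodule.coe_norm, Prod.norm_def]
    refine max_le ((hG.norm_fst_le p.2 hr).trans ?_) ((hG.norm_snd_le p.2 r).trans ?_)
    · exact mul_le_mul_of_nonneg_right (le_max_left _ _) (norm_nonneg _)
    · exact le_mul_of_one_le_left (norm_nonneg _) (le_max_right _ _)
  have hclosed : IsClosed (L.range : Set E) := by
    rw [LinearMap.coe_range]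
    exact hanti.isClosed_range L.uniformContinuous
  have : CompleteSpace L.range := hclosed.completeSpace_coe
  have htop : L.range = ⊤ := by
    rw [← Submodule.orthogonal_eq_bot_iff, Submodule.eq_bot_iff]
    intro w hw
    rw [Submodule.mem_orthogonal] at hw
    exact hG.eq_zero_of_inner_smulSub hr fun p hp => hw _ ⟨⟨p, hp⟩, rfl⟩
  have hf : f ∈ L.range := htop ▸ Submodule.mem_top
  obtain ⟨p, hp⟩ := hf
  exact ⟨p, p.2, hp⟩

theorem IsSkewAdjoint.exists_resolvent (hG : IsSkewAdjoint G) {r : ℝ} (hr : r ≠ 0) :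
    ∃ R : E →L[𝕜] E, IsResolvent G r R := by
  choose P hPG hP using hG.exists_smulSub_eq hr
  let R₀ : E →ₗ[𝕜] E :=
    { toFun := fun f => (P f).1
      map_add' := fun f g => by
        rw [hG.eq_of_smulSub_eq hr (hPG (f + g)) (G.add_mem (hPG f) (hPG g))
          (by rw [map_add, hP, hP, hP]), Prod.fst_add]
      map_smul' := fun c f => by
        rw [hG.eq_of_smulSub_eq hr (hPG (c • f)) (G.smul_mem c (hPG f))
          (by rw [map_smul, hP, hP]), Prod.smul_fst, RingHom.id_apply] }
  have hbound : ∀ f, ‖R₀ f‖ ≤ |r|⁻¹ * ‖f‖ := fun f => by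
    have h := hG.norm_fst_le (hPG f) hr
    rwa [← smulSub_apply, hP] at h
  refine ⟨R₀.mkContinuous _ hbound, fun f => ?_, fun p hp => ?_, hbound⟩
  · have h : (r : 𝕜) • (P f).1 - f = (P f).2 := by
      rw [sub_eq_iff_eq_add', ← sub_eq_iff_eq_add, ← smulSub_apply, hP]
    change ((P f).1, (r : 𝕜) • (P f).1 - f) ∈ G
    rw [h]
    exact hPG f
  · change (P (smulSub 𝕜 E r p)).1 = p.1
    rw [hG.eq_of_smulSub_eq hr (hPG _) hp (hP _)]

/-- By skew-adjointness, `y` is orthogonal to the domain exactly if `(0, y) ∈ G`. -/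
theorem IsSkewAdjoint.dense_domain (hG : IsSkewAdjoint G) (h0 : ∀ y, (0, y) ∈ G → y = 0) :
    Dense (G.map (LinearMap.fst 𝕜 E E) : Set E) := by
  rw [Submodule.dense_iff_topologicalClosure_eq_top, Submodule.topologicalClosure_eq_top_iff,
    Submodule.eq_bot_iff]
  intro y hy
  refine h0 y ((hG _).2 fun q hq => ?_)
  rw [inner_zero_right, zero_add]
  exact (Submodule.mem_orthogonal _ _).1 hy q.1 ⟨q, hq, rfl⟩

end SkewAdjoint

/-! ### Yosida approximation -/

section Yosida

variable {𝕜 E : Type*} [RCLike 𝕜] [NormedAddCommGroup E] [InnerProductSpace 𝕜 E]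
  {G : Submodule 𝕜 (E × E)}

/-- The resolvent identity shows that the graph element produced by `R` at `R' f` is also the one
with `s`-image `R f`; applying `R'` to that image recovers `R (R' f)`. -/
theorem IsResolvent.commute {r s : ℝ} {R R' : E →L[𝕜] E} (hR : IsResolvent G r R)
    (hR' : IsResolvent G s R') : Commute R R' := by
  ext f
  change R (R' f) = R' (R f)
  have h1 := hR.apply_smul_sub _ (hR'.mem f)
  have h2 : (s : 𝕜) • R (R' f) - R f = (r : 𝕜) • R (R' f) - R' f := by
    simp only [map_sub, map_smul] at h1
    rw [eq_sub_iff_add_eq']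
    exact (sub_eq_iff_eq_add.1 h1).symm
  have h3 := hR'.apply_smul_sub _ (h2 ▸ hR.mem (R' f) :
    (R (R' f), (s : 𝕜) • R (R' f) - R f) ∈ G)
  rw [sub_sub_cancel] at h3
  exact h3.symm

/-- The adjoint of the resolvent at `r` is minus the resolvent at `-r`; this is why the
approximations below use both signs. -/
theorem IsResolvent.inner_apply {r : ℝ} {R R' : E →L[𝕜] E} (hG : IsSkewAdjoint G)
    (hR : IsResolvent G r R) (hR' : IsResolvent G (-r) R') (x y : E) :
    inner 𝕜 (R x) y + inner 𝕜 x (R' y) = 0 := by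
  have h := (hG _).1 (hR'.mem y) _ (hR.mem x)
  simp only [inner_sub_left, inner_sub_right, inner_smul_left, inner_smul_right, RCLike.ofReal_neg,
    RCLike.conj_ofReal] at h
  linear_combination -h

theorem IsResolvent.smul_apply_fst {r : ℝ} {R : E →L[𝕜] E} (hR : IsResolvent G r R) {p : E × E}
    (hp : p ∈ G) : (r : 𝕜) • R p.1 = p.1 + R p.2 := by
  have h := hR.apply_smul_sub p hp
  rw [map_sub, map_smul, sub_eq_iff_eq_add] at h
  exact h

theorem IsResolvent.norm_smul_apply_le {r : ℝ} (hr : r ≠ 0) {R : E →L[𝕜] E}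
    (hR : IsResolvent G r R) (x : E) : ‖(r : 𝕜) • R x‖ ≤ ‖x‖ := by
  rw [norm_smul, RCLike.norm_ofReal]
  calc |r| * ‖R x‖ ≤ |r| * (|r|⁻¹ * ‖x‖) := by gcongr; exact hR.norm_le x
    _ = ‖x‖ := by rw [mul_inv_cancel_left₀ (abs_ne_zero.2 hr)]

/-- On the domain, `r R x - x = R (A x)` has norm at most `|r|⁻¹ ‖A x‖`. The maps `r R` are
contractions, so convergence extends by density. -/
theorem tendsto_smul_resolvent {r : ℕ → ℝ} {R : ℕ → E →L[𝕜] E} (hr0 : ∀ n, r n ≠ 0)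
    (hr : Tendsto (fun n => |r n|) atTop atTop) (hR : ∀ n, IsResolvent G (r n) (R n))
    (hdense : Dense (G.map (LinearMap.fst 𝕜 E E) : Set E)) (x : E) :
    Tendsto (fun n => (r n : 𝕜) • R n x) atTop (𝓝 x) := by
  rw [tendsto_iff_norm_sub_tendsto_zero, Metric.tendsto_atTop]
  intro ε hε
  obtain ⟨_, hpx, ⟨p, hp, rfl⟩⟩ := Metric.dense_iff.1 hdense x (ε / 3) (by positivity)
  have hlim : Tendsto (fun n => |r n|⁻¹ * ‖p.2‖) atTop (𝓝 0) := by
    simpa using hr.inv_tendsto_atTop.mul_const ‖p.2‖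
  obtain ⟨N, hN⟩ := eventually_atTop.1 (hlim.eventually_lt_const (show 0 < ε / 3 by positivity))
  refine ⟨N, fun n hn => ?_⟩
  have hpx' : ‖p.1 - x‖ < ε / 3 := by simpa [dist_eq_norm] using hpx
  have h1 : (r n : 𝕜) • R n x - x
      = R n p.2 + (p.1 - x) - (r n : 𝕜) • R n (p.1 - x) := by
    rw [map_sub, smul_sub, (hR n).smul_apply_fst hp]
    abel
  have h2 : ‖R n p.2‖ < ε / 3 := ((hR n).norm_le _).trans_lt (hN n hn)
  rw [dist_zero_right, norm_norm, h1]
  calc _ ≤ ‖R n p.2‖ + ‖p.1 - x‖ + ‖(r n : 𝕜) • R n (p.1 - x)‖ :=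
        (norm_sub_le _ _).trans (by gcongr; exact norm_add_le _ _)
    _ < ε := by linarith [(hR n).norm_smul_apply_le (hr0 n) (p.1 - x)]

variable [CompleteSpace E]

/-- Bounded skew-symmetric commuting approximations of a skew-adjoint operator. -/
theorem IsSkewAdjoint.exists_approx (hG : IsSkewAdjoint G) (h0 : ∀ y, (0, y) ∈ G → y = 0) :
    ∃ B : ℕ → E →L[𝕜] E, (∀ n, IsSkewSymm (B n)) ∧ (∀ m n, Commute (B m) (B n)) ∧
      (∀ p ∈ G, ∀ n, ‖B n p.1‖ ≤ ‖p.2‖) ∧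
      ∀ p ∈ G, Tendsto (fun n => B n p.1) atTop (𝓝 p.2) := by
  set r : ℕ → ℝ := fun n => n + 1 with hrdef
  have hr0 : ∀ n, r n ≠ 0 := fun n => by positivity
  have hr0' : ∀ n, -r n ≠ 0 := fun n => neg_ne_zero.2 (hr0 n)
  have hrlim : Tendsto (fun n => |r n|) atTop atTop :=
    tendsto_abs_atTop_atTop.comp (tendsto_natCast_atTop_atTop.atTop_add tendsto_const_nhds)
  have hrlim' : Tendsto (fun n => |-r n|) atTop atTop := by simpa using hrlim
  choose R hR using fun n => hG.exists_resolvent (hr0 n)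
  choose R' hR' using fun n => hG.exists_resolvent (hr0' n)
  have hdense := hG.dense_domain h0
  -- This is `r² A (r² - A²)⁻¹`, the mean of the Yosida approximations at `r` and `-r`. The
  -- symmetrisation makes it skew.
  let B : ℕ → E →L[𝕜] E := fun n => (((r n) ^ 2 / 2 : ℝ) : 𝕜) • (R n + R' n)
  have hB : ∀ n x, B n x = (((r n) ^ 2 / 2 : ℝ) : 𝕜) • (R n x + R' n x) := fun n x => rfl
  have hBp : ∀ p ∈ G, ∀ n, B n p.1 =
      (2⁻¹ : 𝕜) • ((r n : 𝕜) • R n p.2 + ((-r n : ℝ) : 𝕜) • R' n p.2) := by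
    intro p hp n
    have h1 := (hR n).smul_apply_fst hp
    have h2 := (hR' n).smul_apply_fst hp
    have h3 : (r n : 𝕜) • (R n p.1 + R' n p.1) = R n p.2 - R' n p.2 := by
      rw [RCLike.ofReal_neg, neg_smul, neg_eq_iff_eq_neg] at h2
      rw [smul_add, h1, h2]
      abel
    have h4 : (((r n) ^ 2 / 2 : ℝ) : 𝕜) = (2⁻¹ * r n : 𝕜) * r n := by
      push_cast
      ring
    rw [hB, h4, mul_smul, h3, mul_smul, smul_sub, RCLike.ofReal_neg, neg_smul, sub_eq_add_neg]
  refine ⟨B, fun n x y => ?_, fun m n => ?_, fun p hp n => ?_, fun p hp => ?_⟩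
  · have h1 := (hR n).inner_apply hG (hR' n) x y
    have h2 := (hR' n).inner_apply hG (by rw [neg_neg]; exact hR n) x y
    simp only [hB, inner_smul_left, inner_smul_right, RCLike.conj_ofReal, inner_add_left,
      inner_add_right]
    linear_combination (((r n) ^ 2 / 2 : ℝ) : 𝕜) * (h1 + h2)
  · have h1 := (hR m).commute (hR n)
    have h2 := (hR m).commute (hR' n)
    have h3 := (hR' m).commute (hR n)
    have h4 := (hR' m).commute (hR' n)
    exact (((h1.add_right h2).add_left (h3.add_right h4)).smul_left _).smul_right _
  · rw [hBp p hp, norm_smul, norm_inv, RCLike.norm_ofNat, inv_mul_le_iff₀ two_pos, two_mul]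
    exact (norm_add_le _ _).trans (add_le_add ((hR n).norm_smul_apply_le (hr0 n) _)
      ((hR' n).norm_smul_apply_le (hr0' n) _))
  · simp only [hBp p hp]
    have h := ((tendsto_smul_resolvent hr0 hrlim hR hdense p.2).add
      (tendsto_smul_resolvent hr0' hrlim' hR' hdense p.2)).const_smul (2⁻¹ : 𝕜)
    rwa [← two_smul 𝕜 p.2, inv_smul_smul₀ two_ne_zero] at h

end Yosida

/-! ### Stone's theorem -/

section Stone

variable {𝕜 E : Type*} [RCLike 𝕜] [NormedAddCommGroup E] [InnerProductSpace 𝕜 E]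

/-- The derivatives at `0` of two orbits of a group that preserves the form `⟨·, H ·⟩` are related
by skew-symmetry. -/
theorem inner_add_inner_eq_zero_of_tendsto {T : ℝ → E →ₗ[𝕜] E} (H : E →L[𝕜] E) {u v x y : E}
    (hcont : Tendsto (fun t => T t x) (𝓝 0) (𝓝 x))
    (hinner : ∀ t, inner 𝕜 (T t u) (H (T t x)) = inner 𝕜 u (H x))
    (hu : Tendsto (fun t : ℝ => ((t⁻¹ : ℝ) : 𝕜) • (T t u - u)) (𝓝[≠] 0) (𝓝 v))
    (hx : Tendsto (fun t : ℝ => ((t⁻¹ : ℝ) : 𝕜) • (T t x - x)) (𝓝[≠] 0) (𝓝 y)) :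
    inner 𝕜 v (H x) + inner 𝕜 u (H y) = 0 := by
  have h1 := (hu.inner (𝕜 := 𝕜) (((H.continuous.tendsto x).comp hcont).mono_left
    nhdsWithin_le_nhds)).add
    ((tendsto_const_nhds (x := u)).inner (𝕜 := 𝕜) ((H.continuous.tendsto y).comp hx))
  -- Before passing to the limit the sum is `t⁻¹ (⟨T t u, H (T t x)⟩ - ⟨u, H x⟩)`, which is zero by
  -- invariance.
  refine tendsto_nhds_unique h1 (tendsto_const_nhds.congr fun t => ?_)
  simp only [Function.comp_apply]
  rw [map_smul, map_sub, inner_smul_left, inner_smul_right, RCLike.conj_ofReal, ← mul_add,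
    inner_sub_left, inner_sub_right, hinner]
  ring

variable [CompleteSpace E] {G : Submodule 𝕜 (E × E)}

section RealStructure

variable [NormedSpace ℝ E] [IsScalarTower ℝ 𝕜 E]

/-- On `D`, `e^{tB_m}y - e^{tB_n}y = e^{tB_n}(e^{t(B_m - B_n)}y - y)` has norm at most `|t| ‖(B_m -
B_n)y‖`. Since all the groups are isometric, an `ε/3` argument reaches every vector. -/
theorem cauchySeq_expGroup {B : ℕ → E →L[𝕜] E} (hB : ∀ n, IsSkewSymm (B n))
    (hcomm : ∀ m n, Commute (B m) (B n)) {D : Set E} (hD : Dense D)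
    (hconv : ∀ x ∈ D, CauchySeq fun n => B n x) (t : ℝ) (x : E) :
    CauchySeq fun n => expGroup (B n) t x := by
  rw [Metric.cauchySeq_iff]
  intro ε hε
  obtain ⟨y, hxy, hy⟩ := Metric.dense_iff.1 hD x (ε / 3) (by positivity)
  have hxy : ‖x - y‖ < ε / 3 := by
    rw [← dist_eq_norm, dist_comm]
    exact hxy
  -- The summand `1` keeps the denominator positive when `t = 0`.
  obtain ⟨N, hN⟩ := Metric.cauchySeq_iff.1 (hconv y hy) (ε / 3 / (|t| + 1)) (by positivity)
  refine ⟨N, fun m hm n hn => ?_⟩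
  have hskew : IsSkewSymm (B m - B n) := fun u v => by
    simp only [sub_apply, inner_sub_left, inner_sub_right]
    linear_combination hB m u v - hB n u v
  have h1 : ‖expGroup (B m) t y - expGroup (B n) t y‖ < ε / 3 := by
    calc ‖expGroup (B m) t y - expGroup (B n) t y‖
        = ‖expGroup (B n) t (expGroup (B m - B n) t y - y)‖ := by
          rw [expGroup_sub_mul (hcomm m n), map_sub]
          rfl
      _ ≤ ‖(B m - B n) y‖ * |t| := by
          rw [(hB n).norm_expGroup]
          exact hskew.norm_expGroup_sub_le y t
      _ ≤ ‖(B m - B n) y‖ * (|t| + 1) := by gcongr; linarith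
      _ < ε / 3 := by
          rw [← lt_div_iff₀ (by positivity)]
          simpa [dist_eq_norm] using hN m hm n hn
  have h2 : expGroup (B m) t x - expGroup (B n) t x = expGroup (B m) t (x - y)
      + (expGroup (B m) t y - expGroup (B n) t y) - expGroup (B n) t (x - y) := by
    simp only [map_sub]
    abel
  rw [dist_eq_norm, h2]
  calc _ ≤ ‖expGroup (B m) t (x - y)‖ + ‖expGroup (B m) t y - expGroup (B n) t y‖
          + ‖expGroup (B n) t (x - y)‖ := (norm_sub_le _ _).trans (by gcongr; exact norm_add_le _ _)
    _ < ε := by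
      rw [(hB m).norm_expGroup, (hB n).norm_expGroup]
      linarith

/-- The modulus of continuity at `0` does not depend on `n`, which is what lets strong continuity
survive the limit. -/
theorem exists_uniform_norm_expGroup_sub_le {B : ℕ → E →L[𝕜] E} (hB : ∀ n, IsSkewSymm (B n))
    {D : Set E} (hD : Dense D) (hbdd : ∀ x ∈ D, ∃ C, ∀ n, ‖B n x‖ ≤ C) (x : E) {ε : ℝ}
    (hε : 0 < ε) : ∃ δ > 0, ∀ t, |t| ≤ δ → ∀ n, ‖expGroup (B n) t x - x‖ ≤ ε := by
  obtain ⟨y, hxy, hy⟩ := Metric.dense_iff.1 hD x (ε / 3) (by positivity)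
  have hxy : ‖x - y‖ < ε / 3 := by
    rw [← dist_eq_norm, dist_comm]
    exact hxy
  obtain ⟨C, hC⟩ := hbdd y hy
  have hC0 : 0 ≤ C := (norm_nonneg _).trans (hC 0)
  refine ⟨ε / 3 / (C + 1), by positivity, fun t ht n => ?_⟩
  have h1 : ‖expGroup (B n) t y - y‖ ≤ ε / 3 := by
    refine ((hB n).norm_expGroup_sub_le y t).trans ?_
    rw [le_div_iff₀ (by positivity)] at ht
    nlinarith [hC n, abs_nonneg t]
  have h2 : expGroup (B n) t x - x = expGroup (B n) t (x - y) + (expGroup (B n) t y - y)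
      - (x - y) := by
    simp only [map_sub]
    abel
  rw [h2]
  calc _ ≤ ‖expGroup (B n) t (x - y)‖ + ‖expGroup (B n) t y - y‖ + ‖x - y‖ :=
        (norm_sub_le _ _).trans (by gcongr; exact norm_add_le _ _)
    _ ≤ ε := by
      rw [(hB n).norm_expGroup]
      linarith

/-- Strong limits of commuting unitary groups with uniformly bounded convergent generators. -/
theorem exists_limit_group {B : ℕ → E →L[𝕜] E} (hB : ∀ n, IsSkewSymm (B n))
    (hcomm : ∀ m n, Commute (B m) (B n)) {D : Set E} (hD : Dense D)
    (hbdd : ∀ x ∈ D, ∃ C, ∀ n, ‖B n x‖ ≤ C) (hconv : ∀ x ∈ D, CauchySeq fun n => B n x) :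
    ∃ T : ℝ → E →ₗ[𝕜] E, (∀ x, T 0 x = x) ∧ (∀ s t x, T (s + t) x = T s (T t x)) ∧
      (∀ x, Tendsto (fun t => T t x) (𝓝 0) (𝓝 x)) ∧
      (∀ t x y, inner 𝕜 (T t x) (T t y) = inner 𝕜 x y) ∧
      ∀ x y, Tendsto (fun n => B n x) atTop (𝓝 y) →
        Tendsto (fun t : ℝ => t⁻¹ • (T t x - x)) (𝓝[≠] 0) (𝓝 y) := by
  choose U hU using fun t x =>
    cauchySeq_tendsto_of_complete (cauchySeq_expGroup hB hcomm hD hconv t x)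
  let T : ℝ → E →ₗ[𝕜] E := fun t =>
    { toFun := U t
      map_add' := fun x y => tendsto_nhds_unique (hU t (x + y)) (by
        simpa only [map_add] using (hU t x).add (hU t y))
      map_smul' := fun c x => tendsto_nhds_unique (hU t (c • x)) (by
        simpa only [map_smul, RingHom.id_apply] using (hU t x).const_smul c) }
  have hT : ∀ t x, Tendsto (fun n => expGroup (B n) t x) atTop (𝓝 (T t x)) := hU
  have hnorm : ∀ t x, ‖T t x‖ = ‖x‖ := fun t x =>
    tendsto_nhds_unique (hT t x).norm (by
      simp only [(hB _).norm_expGroup]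
      exact tendsto_const_nhds)
  have hunif : ∀ x, ∀ ε > 0, ∃ δ > 0, ∀ t, |t| ≤ δ → ∀ n, ‖expGroup (B n) t x - x‖ ≤ ε :=
    fun x ε hε => exists_uniform_norm_expGroup_sub_le hB hD hbdd x hε
  refine ⟨T, fun x => ?_, fun s t x => ?_, fun x => ?_, fun t x y => ?_, fun x y hxy => ?_⟩
  · refine tendsto_nhds_unique (hT 0 x) ?_
    simp [expGroup_zero]
  · refine tendsto_nhds_unique (hT (s + t) x) ?_
    -- Isometry permits replacing the varying argument by its limit.
    have h1 : Tendsto (fun n => expGroup (B n) s (expGroup (B n) t x - T t x)) atTop (𝓝 0) := by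
      rw [tendsto_zero_iff_norm_tendsto_zero]
      simp only [(hB _).norm_expGroup]
      exact tendsto_iff_norm_sub_tendsto_zero.1 (hT t x)
    have h2 := h1.add (hT s (T t x))
    simpa [expGroup_add] using h2
  · rw [Metric.tendsto_nhds_nhds]
    intro ε hε
    obtain ⟨δ, hδ, h⟩ := hunif x (ε / 2) (by positivity)
    refine ⟨δ, hδ, fun t ht => ?_⟩
    have ht' : |t| ≤ δ := by simpa using ht.le
    rw [dist_eq_norm]
    exact (le_of_tendsto ((hT t x).sub_const x).norm
      (Eventually.of_forall (h t ht'))).trans_lt (by linarith)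
  · refine tendsto_nhds_unique ((hT t x).inner (hT t y)) ?_
    simp only [(hB _).inner_expGroup]
    exact tendsto_const_nhds
  · rw [Metric.tendsto_nhdsWithin_nhds]
    intro ε hε
    obtain ⟨δ, hδ, h⟩ := hunif y (ε / 2) (by positivity)
    refine ⟨δ, hδ, fun t ht0 ht => ?_⟩
    have ht0' : t ≠ 0 := ht0
    have ht' : |t| ≤ δ := by simpa using ht.le
    -- Pass to the limit in the mean value estimate with `z = y`: the defect `‖B n x - y‖`
    -- disappears.
    have h1 : ‖T t x - x - t • y‖ ≤ (0 + ε / 2) * |t| := by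
      refine le_of_tendsto_of_tendsto (((hT t x).sub_const x).sub_const (t • y)).norm
        (((tendsto_iff_norm_sub_tendsto_zero.1 hxy).add_const (ε / 2)).mul_const |t|)
        (Eventually.of_forall fun n => ?_)
      exact (hB n).norm_expGroup_sub_sub_le x y t fun s hs => h s (hs.trans ht') n
    have h2 : t⁻¹ • (T t x - x) - y = t⁻¹ • (T t x - x - t • y) := by
      rw [smul_sub t⁻¹ (T t x - x), inv_smul_smul₀ ht0']
    rw [dist_eq_norm, h2, norm_smul, norm_inv, Real.norm_eq_abs,
      inv_mul_lt_iff₀ (abs_pos.2 ht0')]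
    refine h1.trans_lt ?_
    rw [zero_add, mul_comm]
    exact mul_lt_mul_of_pos_left (by linarith) (abs_pos.2 ht0')

end RealStructure

/-- **Stone's theorem**: a skew-adjoint operator generates a unitary group. -/
theorem IsSkewAdjoint.exists_unitary_group (hG : IsSkewAdjoint G)
    (h0 : ∀ y, (0, y) ∈ G → y = 0) :
    ∃ T : ℝ → E →ₗ[𝕜] E, (∀ x, T 0 x = x) ∧ (∀ s t x, T (s + t) x = T s (T t x)) ∧
      (∀ x, Tendsto (fun t => T t x) (𝓝 0) (𝓝 x)) ∧
      (∀ t x y, inner 𝕜 (T t x) (T t y) = inner 𝕜 x y) ∧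
      ∀ x y, (x, y) ∈ G ↔
        Tendsto (fun t : ℝ => ((t⁻¹ : ℝ) : 𝕜) • (T t x - x)) (𝓝[≠] 0) (𝓝 y) := by
  let _ : NormedSpace ℝ E := NormedSpace.restrictScalars ℝ 𝕜 E
  have _ : IsScalarTower ℝ 𝕜 E := RestrictScalars.isScalarTower ℝ 𝕜 E
  obtain ⟨B, hB, hcomm, hbdd, hconv⟩ := hG.exists_approx h0
  obtain ⟨T, hT0, hTadd, hTcont, hTinner, hTgen⟩ := exists_limit_group hB hcomm
    (hG.dense_domain h0)
    (by rintro _ ⟨p, hp, rfl⟩; exact ⟨_, hbdd p hp⟩)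
    (by rintro _ ⟨p, hp, rfl⟩; exact (hconv p hp).cauchySeq)
  have hgen : ∀ x y, (x, y) ∈ G →
      Tendsto (fun t : ℝ => ((t⁻¹ : ℝ) : 𝕜) • (T t x - x)) (𝓝[≠] 0) (𝓝 y) := fun x y hxy => by
    have h := hTgen x y (hconv _ hxy)
    refine h.congr fun t => ?_
    rw [← algebraMap_smul 𝕜]
  -- For the converse inclusion, the derivative of an orbit pairs skewly with all of `G`, so
  -- maximality puts it in `G`.
  refine ⟨T, hT0, hTadd, hTcont, hTinner, fun x y => ⟨hgen x y, fun h => (hG _).2 fun q hq => ?_⟩⟩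
  exact inner_add_inner_eq_zero_of_tendsto (.id 𝕜 E) (hTcont x) (fun t => hTinner t _ _)
    (hgen _ _ hq) h

end Stone

/-! ### Change of scalar product -/

section EnergySpace

universe u

variable {𝕜 : Type*} {E : Type u} [RCLike 𝕜] [NormedAddCommGroup E] [InnerProductSpace 𝕜 E]

/-- For a bounded coercive symmetric operator `H` on the Hilbert space `E`, the space `E` with the
scalar product `⟨·, H ·⟩` is a Hilbert space. -/
theorem exists_energySpace [CompleteSpace E] (H : E →L[𝕜] E)
    (hsymm : ∀ x y, inner 𝕜 (H x) y = inner 𝕜 x (H y)) {c : ℝ} (hc : 0 < c)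
    (hpos : ∀ x, c * ‖x‖ ^ 2 ≤ RCLike.re (inner 𝕜 x (H x))) :
    ∃ (F : Type u) (_ : NormedAddCommGroup F) (_ : InnerProductSpace 𝕜 F) (_ : CompleteSpace F)
      (e : E ≃ₗ[𝕜] F), ∀ x y, inner 𝕜 (e x) (e y) = inner 𝕜 x (H y) := by
  -- An opaque linear copy of `E`, carrying no topology, so that the new norm cannot clash with the
  -- old one.
  obtain ⟨F, hF, hF', ⟨e⟩⟩ : ∃ (F : Type u) (_ : AddCommGroup F) (_ : Module 𝕜 F),
    Nonempty (E ≃ₗ[𝕜] F) := ⟨E, inferInstance, inferInstance, ⟨.refl 𝕜 E⟩⟩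
  have hnonneg : ∀ x, 0 ≤ RCLike.re (inner 𝕜 x (H x)) := fun x =>
    (mul_nonneg hc.le (sq_nonneg _)).trans (hpos x)
  let core : InnerProductSpace.Core 𝕜 F :=
    { inner := fun x y => inner 𝕜 (e.symm x) (H (e.symm y))
      conj_inner_symm := fun x y => by rw [inner_conj_symm, hsymm]
      re_inner_nonneg := fun x => hnonneg _
      add_left := fun x y z => by rw [map_add, inner_add_left]
      smul_left := fun x y r => by rw [map_smul, inner_smul_left]
      definite := fun x hx => by
        have h := hpos (e.symm x)
        have hx' : inner 𝕜 (e.symm x) (H (e.symm x)) = 0 := hx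
        rw [hx', map_zero] at h
        have h2 : ‖e.symm x‖ ^ 2 = 0 :=
          le_antisymm (nonpos_of_mul_nonpos_right h hc) (sq_nonneg _)
        simpa using h2 }
  let i1 : NormedAddCommGroup F := core.toNormedAddCommGroup
  let i2 : InnerProductSpace 𝕜 F := InnerProductSpace.ofCore core.toCore
  have hinner : ∀ x y, inner 𝕜 (e x) (e y) = inner 𝕜 x (H y) := fun x y => by
    change inner 𝕜 (e.symm (e x)) (H (e.symm (e y))) = _
    simp
  have hnorm : ∀ x, ‖e x‖ ^ 2 = RCLike.re (inner 𝕜 x (H x)) := fun x => by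
    rw [@norm_sq_eq_re_inner 𝕜, hinner]
  have hle : ∀ x, ‖e x‖ ≤ Real.sqrt ‖H‖ * ‖x‖ := fun x => by
    refine abs_le_of_sq_le_sq' ?_ (by positivity) |>.2
    rw [hnorm, mul_pow, Real.sq_sqrt (norm_nonneg _), sq, ← mul_assoc, mul_comm (‖H‖ * ‖x‖)]
    exact (RCLike.re_le_norm _).trans ((norm_inner_le_norm _ _).trans
      (mul_le_mul_of_nonneg_left (H.le_opNorm x) (norm_nonneg _)))
  have hge : ∀ y, ‖e.symm y‖ ≤ (Real.sqrt c)⁻¹ * ‖y‖ := fun y => by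
    obtain ⟨x, rfl⟩ := e.surjective y
    rw [e.symm_apply_apply, le_inv_mul_iff₀ (Real.sqrt_pos.2 hc)]
    refine abs_le_of_sq_le_sq' ?_ (norm_nonneg _) |>.2
    rw [mul_pow, Real.sq_sqrt hc.le, hnorm]
    exact hpos x
  let e' : E ≃L[𝕜] F :=
    { e with
      continuous_toFun := (e.toLinearMap.mkContinuous _ hle).continuous
      continuous_invFun := (e.symm.toLinearMap.mkContinuous _ hge).continuous }
  -- Boundedness and coercivity of `H` make the two norms equivalent.
  have hcomplete : CompleteSpace F := 
    (e'.isUniformEmbedding.completeSpace_congr e'.surjective).1 inferInstance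
  exact ⟨F, i1, i2, hcomplete, e, hinner⟩

/-- The submodule of `E × E` given by a relation that is skew-adjoint. -/
theorem exists_submodule_of_skewAdjoint {P : E → E → Prop}
    (hP : ∀ x y, P x y ↔ ∀ u v, P u v → inner 𝕜 v x + inner 𝕜 u y = 0) :
    ∃ G : Submodule 𝕜 (E × E), IsSkewAdjoint G ∧ ∀ x y, (x, y) ∈ G ↔ P x y := by
  let G : Submodule 𝕜 (E × E) :=
    { carrier := {p | P p.1 p.2}
      zero_mem' := (hP _ _).2 fun u v _ => by simp
      add_mem' := fun {p q} hp hq => (hP _ _).2 fun u v huv => by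
        rw [Prod.fst_add, Prod.snd_add, inner_add_right, inner_add_right]
        linear_combination (hP _ _).1 hp u v huv + (hP _ _).1 hq u v huv
      smul_mem' := fun a p hp => (hP _ _).2 fun u v huv => by
        rw [Prod.smul_fst, Prod.smul_snd, inner_smul_right, inner_smul_right]
        linear_combination a * (hP _ _).1 hp u v huv }
  exact ⟨G, fun p => (hP p.1 p.2).trans ⟨fun h q hq => h q.1 q.2 hq, fun h u v huv => h (u, v) huv⟩,
    fun x y => Iff.rfl⟩

/-- A relation that is skew-adjoint for the scalar product `⟨·, H ·⟩` generates a group that is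
unitary for this scalar product. -/
theorem exists_unitary_group_of_skewAdjoint [CompleteSpace E] (H : E →L[𝕜] E)
    (hsymm : ∀ x y, inner 𝕜 (H x) y = inner 𝕜 x (H y)) {c : ℝ} (hc : 0 < c)
    (hpos : ∀ x, c * ‖x‖ ^ 2 ≤ RCLike.re (inner 𝕜 x (H x))) {P : E → E → Prop}
    (hP : ∀ x y, P x y ↔ ∀ u v, P u v → inner 𝕜 v (H x) + inner 𝕜 u (H y) = 0)
    (h0 : ∀ y, P 0 y → y = 0) :
    ∃ T : ℝ → E →ₗ[𝕜] E, (∀ x, T 0 x = x) ∧ (∀ s t x, T (s + t) x = T s (T t x)) ∧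
      (∀ x, Tendsto (fun t => √(RCLike.re (inner 𝕜 (T t x - x) (H (T t x - x))))) (𝓝 0) (𝓝 0)) ∧
      (∀ t x y, inner 𝕜 (T t x) (H (T t y)) = inner 𝕜 x (H y)) ∧
      ∀ x y, P x y ↔ Tendsto (fun t : ℝ => √(RCLike.re (inner 𝕜
        (((t⁻¹ : ℝ) : 𝕜) • (T t x - x) - y) (H (((t⁻¹ : ℝ) : 𝕜) • (T t x - x) - y)))))
        (𝓝[≠] 0) (𝓝 0) := by
  obtain ⟨F, _, _, _, e, he⟩ := exists_energySpace H hsymm hc hpos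
  obtain ⟨G, hG, hGP⟩ := exists_submodule_of_skewAdjoint (𝕜 := 𝕜)
    (P := fun u v : F => P (e.symm u) (e.symm v)) fun x y => by
      rw [hP]
      refine ⟨fun h u v huv => ?_, fun h u v huv => ?_⟩
      · have h1 := h _ _ huv
        rwa [← he, ← he, e.apply_symm_apply, e.apply_symm_apply, e.apply_symm_apply,
          e.apply_symm_apply] at h1
      · have h1 := h (e u) (e v) (by simpa using huv)
        rw [← he, ← he, e.apply_symm_apply, e.apply_symm_apply]
        exact h1
  obtain ⟨T, hT0, hTadd, hTcont, hTinner, hTgen⟩ := hG.exists_unitary_group fun y hy => by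
    have h1 := h0 (e.symm y) (by simpa using (hGP _ _).1 hy)
    simpa using h1
  have hnorm : ∀ x, √(RCLike.re (inner 𝕜 x (H x))) = ‖e x‖ := fun x => by
    rw [← he, ← @norm_eq_sqrt_re_inner 𝕜]
  refine ⟨fun t => e.symm.toLinearMap ∘ₗ T t ∘ₗ e.toLinearMap, fun x => by simp [hT0],
    fun s t x => by simp [hTadd], fun x => ?_, fun t x y => ?_, fun x y => ?_⟩
  · simp only [hnorm]
    simpa using tendsto_iff_norm_sub_tendsto_zero.1 (hTcont (e x))
  · simp [← he, hTinner]
  · have h1 := hTgen (e x) (e y)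
    rw [hGP, e.symm_apply_apply, e.symm_apply_apply, tendsto_iff_norm_sub_tendsto_zero] at h1
    simp only [hnorm]
    simpa using h1

/-- A bounded positive symmetric operator with a bounded inverse is coercive. -/
theorem exists_coercive {H K : E →L[𝕜] E} (hsymm : ∀ x y, inner 𝕜 (H x) y = inner 𝕜 x (H y))
    (hpos : ∀ x, 0 ≤ RCLike.re (inner 𝕜 x (H x))) (hHK : ∀ x, H (K x) = x) :
    ∃ c > 0, ∀ x, c * ‖x‖ ^ 2 ≤ RCLike.re (inner 𝕜 x (H x)) := by
  set b : ℝ := ‖K‖ + 1 with hb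
  have hb0 : 0 < b := by positivity
  refine ⟨b⁻¹, inv_pos.2 hb0, fun x => ?_⟩
  -- With `HK = 1`, positivity at this vector reads `⟨x, Hx⟩ - 2b⁻¹‖x‖² + b⁻² Re ⟨Kx, x⟩ ≥ 0`. The
  -- last term is at most `b⁻¹‖x‖²`, which leaves the constant `b⁻¹`.
  have h1 := hpos (x - ((b⁻¹ : ℝ) : 𝕜) • K x)
  have h2 : RCLike.re (inner 𝕜 (K x) x) ≤ b * ‖x‖ ^ 2 := by
    calc RCLike.re (inner 𝕜 (K x) x) ≤ ‖K x‖ * ‖x‖ := re_inner_le_norm _ _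
      _ ≤ b * ‖x‖ * ‖x‖ := by
        gcongr
        exact (K.le_opNorm x).trans (by gcongr; linarith)
      _ = b * ‖x‖ ^ 2 := by ring
  have h3 : inner 𝕜 (K x) (H x) = inner 𝕜 x x := by rw [← hsymm, hHK]
  simp only [map_sub, map_smul, hHK, inner_sub_left, inner_sub_right, inner_smul_left,
    inner_smul_right, RCLike.conj_ofReal, RCLike.re_ofReal_mul, h3, inner_self_eq_norm_sq] at h1
  have h4 : b⁻¹ * (b⁻¹ * RCLike.re (inner 𝕜 (K x) x)) ≤ b⁻¹ * ‖x‖ ^ 2 := by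
    refine mul_le_mul_of_nonneg_left ?_ (inv_nonneg.2 hb0.le)
    rwa [inv_mul_le_iff₀ hb0]
  linarith

end EnergySpace

/-! ### Integration by parts for integrable functions -/

section Primitive

variable {𝕜 V : Type*} [RCLike 𝕜] [NormedAddCommGroup V] [InnerProductSpace 𝕜 V]

theorem integrableOn_inner_continuousOn {f u : ℝ → V} {b : ℝ} (hf : IntegrableOn f (Ioc 0 b))
    (hu : ContinuousOn u (Icc 0 b)) :
    IntegrableOn (fun t => inner 𝕜 (f t) (u t)) (Ioc 0 b) := by
  obtain ⟨C, hC⟩ := isCompact_Icc.exists_bound_of_continuousOn hu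
  refine (hf.norm.mul_const C).mono' (hf.1.inner ?_) ?_
  · exact (hu.mono Ioc_subset_Icc_self).aestronglyMeasurable measurableSet_Ioc
  · filter_upwards [ae_restrict_mem measurableSet_Ioc] with t ht
    exact (norm_inner_le_norm _ _).trans
      (mul_le_mul_of_nonneg_left (hC t (Ioc_subset_Icc_self ht)) (norm_nonneg _))

theorem integrableOn_continuousOn_inner {f u : ℝ → V} {b : ℝ} (hf : IntegrableOn f (Ioc 0 b))
    (hu : ContinuousOn u (Icc 0 b)) :
    IntegrableOn (fun t => inner 𝕜 (u t) (f t)) (Ioc 0 b) := by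
  have h := (integrableOn_inner_continuousOn (𝕜 := 𝕜) hf hu)
  refine (RCLike.conjCLE.toContinuousLinearMap.integrable_comp h).congr
    (Eventually.of_forall fun t => ?_)
  exact inner_conj_symm _ _

variable [NormedSpace ℝ V]

theorem continuousOn_primitive {g : ℝ → V} {b : ℝ} (hb : 0 ≤ b)
    (hg : IntervalIntegrable g volume 0 b) :
    ContinuousOn (fun t => ∫ s in 0..t, g s) (Icc 0 b) := by
  rw [← uIcc_of_le hb]
  refine intervalIntegral.continuousOn_primitive_interval ?_
  rw [uIcc_of_le hb, integrableOn_Icc_iff_integrableOn_Ioc]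
  exact (intervalIntegrable_iff_integrableOn_Ioc_of_le hb).1 hg

variable [CompleteSpace V]

theorem integral_inner_const {α : Type*} [MeasurableSpace α] {μ : Measure α} {f : α → V}
    (hf : Integrable f μ) (c : V) : ∫ x, inner 𝕜 (f x) c ∂μ = inner 𝕜 (∫ x, f x ∂μ) c := by
  rw [← inner_conj_symm, ← integral_inner hf, ← integral_conj]
  simp only [inner_conj_symm]

/-- Integration by parts for two primitives that vanish at the left end. -/
theorem integral_inner_primitive {f g : ℝ → V} {b : ℝ} (hb : 0 ≤ b)
    (hf : IntervalIntegrable f volume 0 b) (hg : IntervalIntegrable g volume 0 b) :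
    (∫ t in 0..b, inner 𝕜 (∫ s in 0..t, f s) (g t)) +
      ∫ t in 0..b, inner 𝕜 (f t) (∫ s in 0..t, g s)
      = inner 𝕜 (∫ s in 0..b, f s) (∫ s in 0..b, g s) := by
  have hf' := (intervalIntegrable_iff_integrableOn_Ioc_of_le hb).1 hf
  have hg' := (intervalIntegrable_iff_integrableOn_Ioc_of_le hb).1 hg
  set μ : Measure ℝ := volume.restrict (Ioc 0 b) with hμ
  have hA : MeasurableSet {p : ℝ × ℝ | p.2 ≤ p.1} := measurableSet_le measurable_snd measurable_fst
  have hk : Integrable (fun p : ℝ × ℝ => inner 𝕜 (f p.2) (g p.1)) (μ.prod μ) := by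
    refine (hg'.norm.mul_prod hf'.norm).mono
      (hf'.1.comp_snd.inner hg'.1.comp_fst) (Eventually.of_forall fun p => ?_)
    rw [norm_mul, norm_norm, norm_norm, mul_comm]
    exact norm_inner_le_norm _ _
  -- Fubini on the triangle `s ≤ t` in the square `(0, b]²`; the two inner integrals are computed in
  -- `h1` and `h2`.
  have hswap := integral_integral_swap (μ := μ) (ν := μ)
    (f := fun t s => {p : ℝ × ℝ | p.2 ≤ p.1}.indicator (fun p => inner 𝕜 (f p.2) (g p.1)) (t, s))
    (hk.indicator hA)
  have h1 : ∀ t ∈ Ioc 0 b, (∫ s, {p : ℝ × ℝ | p.2 ≤ p.1}.indicator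
      (fun p => inner 𝕜 (f p.2) (g p.1)) (t, s) ∂μ) = inner 𝕜 (∫ s in 0..t, f s) (g t) := by
    intro t ht
    have : ∀ s, {p : ℝ × ℝ | p.2 ≤ p.1}.indicator (fun p => inner 𝕜 (f p.2) (g p.1)) (t, s)
        = (Iic t).indicator (fun s => inner 𝕜 (f s) (g t)) s := fun s => rfl
    simp only [this]
    rw [integral_indicator measurableSet_Iic, hμ, Measure.restrict_restrict measurableSet_Iic,
      Iic_inter_Ioc_of_le ht.2, integral_inner_const (hf'.mono_set (Ioc_subset_Ioc_right ht.2)),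
      intervalIntegral.integral_of_le ht.1.le]
  have h2 : ∀ s ∈ Ioc 0 b, (∫ t, {p : ℝ × ℝ | p.2 ≤ p.1}.indicator
      (fun p => inner 𝕜 (f p.2) (g p.1)) (t, s) ∂μ) =
      inner 𝕜 (f s) (∫ t in 0..b, g t) - inner 𝕜 (f s) (∫ t in 0..s, g t) := by
    intro s hs
    have : ∀ t, {p : ℝ × ℝ | p.2 ≤ p.1}.indicator (fun p => inner 𝕜 (f p.2) (g p.1)) (t, s)
        = (Ici s).indicator (fun t => inner 𝕜 (f s) (g t)) t := fun t => rfl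
    simp only [this]
    have hset : Ici s ∩ Ioc 0 b = Icc s b := by
      ext t
      simp only [mem_inter_iff, mem_Ici, mem_Ioc, mem_Icc]
      exact ⟨fun h => ⟨h.1, h.2.2⟩, fun h => ⟨h.1, hs.1.trans_le h.1, h.2⟩⟩
    have hsub : IntegrableOn g (Ioc s b) := hg'.mono_set (Ioc_subset_Ioc_left hs.1.le)
    rw [integral_indicator measurableSet_Ici, hμ, Measure.restrict_restrict measurableSet_Ici,
      hset, integral_Icc_eq_integral_Ioc, integral_inner hsub,
      ← intervalIntegral.integral_of_le hs.2, ← inner_sub_right,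
      intervalIntegral.integral_interval_sub_left hg
        (hg.mono_set (by rw [uIcc_of_le hb, uIcc_of_le hs.1.le]; exact Icc_subset_Icc_right hs.2))]
  have hfG := integrableOn_inner_continuousOn (𝕜 := 𝕜) hf' (continuousOn_primitive hb hg)
  rw [intervalIntegral.integral_of_le hb, intervalIntegral.integral_of_le hb,
    ← setIntegral_congr_fun measurableSet_Ioc h1, hswap,
    setIntegral_congr_fun measurableSet_Ioc h2, integral_sub _ hfG, sub_add_cancel,
    integral_inner_const hf', ← intervalIntegral.integral_of_le hb]
  exact hf'.inner_const _

/-- Integration by parts for two primitives. -/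
theorem integral_inner_add_primitive {f g : ℝ → V} {b : ℝ} (hb : 0 ≤ b)
    (hf : IntervalIntegrable f volume 0 b) (hg : IntervalIntegrable g volume 0 b) (v w : V) :
    ∫ t in 0..b, (inner 𝕜 (v + ∫ s in 0..t, f s) (g t) + inner 𝕜 (f t) (w + ∫ s in 0..t, g s))
      = inner 𝕜 (v + ∫ s in 0..b, f s) (w + ∫ s in 0..b, g s) - inner 𝕜 v w := by
  have hf' := (intervalIntegrable_iff_integrableOn_Ioc_of_le hb).1 hf
  have hg' := (intervalIntegrable_iff_integrableOn_Ioc_of_le hb).1 hg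
  have hFg := integrableOn_continuousOn_inner (𝕜 := 𝕜) hg' (continuousOn_primitive hb hf)
  have hfG := integrableOn_inner_continuousOn (𝕜 := 𝕜) hf' (continuousOn_primitive hb hg)
  have h := integral_inner_primitive (𝕜 := 𝕜) hb hf hg
  simp only [intervalIntegral.integral_of_le hb] at h ⊢
  simp only [inner_add_left, inner_add_right]
  have h1 : IntegrableOn (fun t => inner 𝕜 v (g t) + inner 𝕜 (∫ s in 0..t, f s) (g t))
    (Ioc 0 b) := (hg'.const_inner v).add hFg
  have h2 : IntegrableOn (fun t => inner 𝕜 (f t) w + inner 𝕜 (f t) (∫ s in 0..t, g s))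
    (Ioc 0 b) := (hf'.inner_const w).add hfG
  rw [integral_add h1 h2, integral_add (hg'.const_inner v) hFg, integral_add (hf'.inner_const w) hfG,
    integral_inner hg', integral_inner_const hf']
  linear_combination h

end Primitive

/-! ### Test functions and the lemma of du Bois-Reymond -/

section TestFunctions

/-- A smooth compactly supported function on `(0, ∞)`. -/
structure IsTest (φ : ℝ → ℝ) : Prop where
  contDiff : ContDiff ℝ ∞ φ
  hasCompactSupport : HasCompactSupport φ
  tsupport_subset : tsupport φ ⊆ Ioi 0

theorem IsTest.deriv {φ : ℝ → ℝ} (h : IsTest φ) : IsTest (deriv φ) :=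
  ⟨(contDiff_infty_iff_deriv.1 h.contDiff).2, h.hasCompactSupport.deriv,
    tsupport_deriv_subset.trans h.tsupport_subset⟩

theorem IsTest.hasDerivAt {φ : ℝ → ℝ} (h : IsTest φ) (x : ℝ) : HasDerivAt φ (_root_.deriv φ x) x :=
  (h.contDiff.differentiable (by simp) x).hasDerivAt

theorem IsTest.eq_zero_of_nonpos {φ : ℝ → ℝ} (h : IsTest φ) {x : ℝ} (hx : x ≤ 0) : φ x = 0 :=
  image_eq_zero_of_notMem_tsupport fun h' => absurd (h.tsupport_subset h') (not_lt.2 hx)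

theorem IsTest.exists_bounds {φ : ℝ → ℝ} (h : IsTest φ) :
    ∃ a b, 0 < a ∧ a < b ∧ tsupport φ ⊆ Icc a b := by
  rcases (tsupport φ).eq_empty_or_nonempty with he | hne
  · exact ⟨1, 2, by norm_num, by norm_num, by simp [he]⟩
  · obtain ⟨a, ha, hmin⟩ := h.hasCompactSupport.isCompact.exists_isLeast hne
    obtain ⟨b, hb, hmax⟩ := h.hasCompactSupport.isCompact.exists_isGreatest hne
    exact ⟨a, b + 1, h.tsupport_subset ha, (hmin hb).trans_lt (by linarith),
      fun x hx => ⟨hmin hx, (hmax hx).trans (by linarith)⟩⟩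

/-- Integrate from the left end of an interval containing the support; vanishing mean makes the
primitive vanish to the right of it as well. -/
theorem IsTest.exists_primitive {φ : ℝ → ℝ} (h : IsTest φ) (h0 : ∫ x, φ x = 0) :
    ∃ ψ, IsTest ψ ∧ _root_.deriv ψ = φ := by
  obtain ⟨a, b, ha, hab, hsupp⟩ := h.exists_bounds
  have hcont := h.contDiff.continuous
  have hzero : ∀ x, x ∉ Icc a b → φ x = 0 := fun x hx =>
    image_eq_zero_of_notMem_tsupport fun h' => hx (hsupp h')
  have hd : ∀ x, HasDerivAt (fun x => ∫ t in a..x, φ t) (φ x) x := fun x =>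
    intervalIntegral.integral_hasDerivAt_right (hcont.intervalIntegrable _ _)
      (hcont.stronglyMeasurableAtFilter _ _) hcont.continuousAt
  have hderiv : _root_.deriv (fun x => ∫ t in a..x, φ t) = φ := funext fun x => (hd x).deriv
  have hout : ∀ x, x ∉ Icc a b → ∫ t in a..x, φ t = 0 := by
    intro x hx
    rcases lt_or_ge x a with hxa | hxa
    · refine (intervalIntegral.integral_congr_ae (g := fun _ => 0) ?_).trans (by simp)
      refine (Measure.ae_ne volume a).mono fun t hta ht => hzero t fun ht' => hta ?_
      rw [uIoc_of_ge hxa.le] at ht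
      exact le_antisymm ht.2 ht'.1
    · have hbx : b < x := lt_of_not_ge fun hxb => hx ⟨hxa, hxb⟩
      rw [intervalIntegral.integral_of_le hxa, ← integral_Icc_eq_integral_Ioc,
        setIntegral_eq_integral_of_forall_compl_eq_zero, h0]
      exact fun t ht => hzero t fun ht' => ht ⟨ht'.1, ht'.2.trans hbx.le⟩
  have hts : tsupport (fun x => ∫ t in a..x, φ t) ⊆ Icc a b :=
    closure_minimal (fun x hx => by_contra fun hx' => hx (hout x hx')) isClosed_Icc
  refine ⟨_, ⟨contDiff_infty_iff_deriv.2 ⟨fun x => (hd x).differentiableAt, ?_⟩, ?_,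
    hts.trans fun x hx => ha.trans_le hx.1⟩, hderiv⟩
  · rw [hderiv]
    exact h.contDiff
  · exact isCompact_Icc.of_isClosed_subset (isClosed_tsupport _) hts

theorem exists_isTest_integral_eq_one : ∃ ψ, IsTest ψ ∧ ∫ x, ψ x = 1 := by
  let f : ContDiffBump (2 : ℝ) := ⟨1 / 2, 1, by norm_num, by norm_num⟩
  refine ⟨f.normed volume, ⟨f.contDiff_normed (n := ⊤), f.hasCompactSupport_normed, ?_⟩,
    f.integral_normed⟩
  rw [f.tsupport_normed_eq, Real.closedBall_eq_Icc]
  intro x hx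
  have h1 : (2 : ℝ) - 1 ≤ x := hx.1
  exact lt_of_lt_of_le (by norm_num) h1

theorem IsTest.sub_smul {φ ψ : ℝ → ℝ} (hφ : IsTest φ) (hψ : IsTest ψ) (c : ℝ) :
    IsTest (fun x => φ x - c * ψ x) := by
  have hs : tsupport (fun x => φ x - c * ψ x) ⊆ tsupport φ ∪ tsupport ψ := by
    refine closure_minimal (fun x hx => ?_)
      ((isClosed_tsupport _).union (isClosed_tsupport _))
    by_contra hx'
    rw [mem_union, not_or] at hx'
    refine hx ?_
    simp only [image_eq_zero_of_notMem_tsupport hx'.1, image_eq_zero_of_notMem_tsupport hx'.2]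
    ring
  exact ⟨hφ.contDiff.sub (contDiff_const.mul hψ.contDiff),
    (hφ.hasCompactSupport.isCompact.union hψ.hasCompactSupport.isCompact).of_isClosed_subset
      (isClosed_tsupport _) hs, hs.trans (union_subset hφ.tsupport_subset hψ.tsupport_subset)⟩

variable {V : Type*} [NormedAddCommGroup V] [NormedSpace ℝ V]

theorem ae_halfLine_pos : ∀ᵐ ζ ∂halfLine, ζ ∈ Ioi (0 : ℝ) := by
  rw [halfLine, ← restrict_Ioi_eq_restrict_Ici]
  exact ae_restrict_mem measurableSet_Ioi

theorem IsTest.integral_halfLine {φ : ℝ → ℝ} (h : IsTest φ) (f : ℝ → V) :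
    ∫ x, φ x • f x ∂halfLine = ∫ x, φ x • f x :=
  setIntegral_eq_integral_of_forall_compl_eq_zero fun x hx => by
    rw [h.eq_zero_of_nonpos (not_le.1 hx).le, zero_smul]

theorem IsTest.integrable_smul {φ : ℝ → ℝ} (h : IsTest φ) {f : ℝ → V}
    (hf : LocallyIntegrable f halfLine) : Integrable (fun x => φ x • f x) halfLine :=
  hf.integrable_smul_left_of_hasCompactSupport h.contDiff.continuous h.hasCompactSupport

/-- The lemma of du Bois-Reymond on the half-line. -/
theorem exists_ae_eq_const [CompleteSpace V] {f : ℝ → V} (hf : LocallyIntegrable f halfLine)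
    (h : ∀ φ, IsTest φ → ∫ x, deriv φ x • f x ∂halfLine = 0) :
    ∃ c, ∀ᵐ x ∂halfLine, f x = c := by
  obtain ⟨ψ, hψ, hψ1⟩ := exists_isTest_integral_eq_one
  set c := ∫ x, ψ x • f x ∂halfLine with hc
  have hconst : LocallyIntegrable (fun _ : ℝ => c) halfLine := locallyIntegrable_const c
  have key : ∀ᵐ x ∂halfLine, x ∈ Ioi (0 : ℝ) → f x - c = 0 := by
    refine isOpen_Ioi.ae_eq_zero_of_integral_contDiff_smul_eq_zero
      ((hf.sub hconst).locallyIntegrableOn _) ?_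
    intro φ h1 h2 h3
    have hφ : IsTest φ := ⟨h1, h2, h3⟩
    have hφint : Integrable φ := h1.continuous.integrable_of_hasCompactSupport h2
    have hψint : Integrable ψ :=
      hψ.contDiff.continuous.integrable_of_hasCompactSupport hψ.hasCompactSupport
    -- Subtracting `(∫ φ) ψ` removes the mean, so what remains is the derivative of a test function.
    obtain ⟨η, hη, hηd⟩ := (hφ.sub_smul hψ (∫ x, φ x)).exists_primitive (by
      rw [integral_sub hφint (hψint.const_mul _), integral_const_mul, hψ1, mul_one, sub_self])
    have h4 := h η hη
    simp only [hηd, sub_smul, mul_smul] at h4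
    have h5 : Integrable (fun x => (∫ x, φ x) • ψ x • f x) halfLine :=
      (hψ.integrable_smul hf).smul (∫ x, φ x)
    rw [integral_sub (hφ.integrable_smul hf) h5,
      integral_smul, ← hc, sub_eq_zero] at h4
    simp only [smul_sub]
    rw [integral_sub (hφ.integrable_smul hf) (hφ.integrable_smul hconst), h4,
      hφ.integral_halfLine, integral_smul_const, sub_self]
  refine ⟨c, ?_⟩
  filter_upwards [key, ae_halfLine_pos] with x h1 h2
  exact sub_eq_zero.1 (h1 h2)

end TestFunctions

/-! ### Boundary values and Green's formula -/

section WeakDerivative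

variable {𝕜 : Type*} [RCLike 𝕜] {d : ℕ}

theorem locallyIntegrable_state (f : State 𝕜 d) : LocallyIntegrable f halfLine :=
  (Lp.memLp f).locallyIntegrable (by norm_num)

theorem intervalIntegrable_state (f : State 𝕜 d) {b : ℝ} (hb : 0 ≤ b) :
    IntervalIntegrable f volume 0 b := by
  have h := (locallyIntegrable_state f).integrableOn_isCompact (isCompact_Icc (a := 0) (b := b))
  change Integrable f ((volume.restrict (Ici 0)).restrict (Icc 0 b)) at h
  rw [Measure.restrict_restrict measurableSet_Icc,
    inter_eq_left.2 Icc_subset_Ici_self] at h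
  exact (intervalIntegrable_iff_integrableOn_Icc_of_le hb).2 h

theorem continuousOn_primitive_state (g : State 𝕜 d) :
    ContinuousOn (fun t => ∫ s in 0..t, g s) (Ici 0) := by
  intro x hx
  have hx' : (0 : ℝ) ≤ x + 1 := add_nonneg hx zero_le_one
  refine (continuousOn_primitive hx' (intervalIntegrable_state g hx') x
    ⟨hx, by linarith⟩).mono_of_mem_nhdsWithin ?_
  exact inter_mem self_mem_nhdsWithin (mem_nhdsWithin_of_mem_nhds (Iic_mem_nhds (by linarith)))

theorem inner_real_smul_left (r : ℝ) (x y : EuclideanSpace 𝕜 (Fin d)) :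
    inner 𝕜 (r • x) y = (r : 𝕜) * inner 𝕜 x y := by
  rw [RCLike.real_smul_eq_coe_smul (K := 𝕜), inner_smul_left, RCLike.conj_ofReal]

theorem inner_real_smul_right (r : ℝ) (x y : EuclideanSpace 𝕜 (Fin d)) :
    inner 𝕜 x (r • y) = (r : 𝕜) * inner 𝕜 x y := by
  rw [RCLike.real_smul_eq_coe_smul (K := 𝕜), inner_smul_right]

/-- The primitive of `g` has weak derivative `g`. -/
theorem IsTest.integral_deriv_smul_primitive {φ : ℝ → ℝ} (hφ : IsTest φ) (g : State 𝕜 d) :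
    ∫ x, _root_.deriv φ x • (∫ s in 0..x, g s) ∂halfLine = - ∫ x, φ x • g x ∂halfLine := by
  obtain ⟨a, b, ha, hab, hsupp⟩ := hφ.exists_bounds
  -- The point `b + 1` lies strictly beyond the support, so the boundary term at the right end
  -- vanishes.
  have hb : 0 ≤ b + 1 := by linarith
  have hzero : ∀ x, x ∉ Ioc 0 (b + 1) → x ∉ tsupport φ := fun x hx h =>
    hx ⟨ha.trans_le (hsupp h).1, by linarith [(hsupp h).2]⟩
  have hres : ∀ η : ℝ → ℝ, tsupport η ⊆ tsupport φ → ∀ f : ℝ → EuclideanSpace 𝕜 (Fin d),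
      IsTest η → ∫ x, η x • f x ∂halfLine = ∫ x in 0..(b + 1), η x • f x := by
    intro η hη f hη'
    rw [hη'.integral_halfLine, intervalIntegral.integral_of_le hb,
      setIntegral_eq_integral_of_forall_compl_eq_zero]
    intro x hx
    rw [image_eq_zero_of_notMem_tsupport fun h => hzero x hx (hη h), zero_smul]
  rw [hres _ tsupport_deriv_subset _ hφ.deriv, hres _ subset_rfl _ hφ]
  have hg := intervalIntegrable_state g hb
  have hd : Continuous (_root_.deriv φ) := hφ.deriv.contDiff.continuous
  have hG := continuousOn_primitive hb hg
  refine ext_inner_left 𝕜 fun e => ?_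
  have hφe : ∀ t, ∫ s in 0..t, _root_.deriv φ s • e = φ t • e := fun t => by
    rw [intervalIntegral.integral_smul_const, intervalIntegral.integral_deriv_eq_sub
      (fun x _ => (hφ.hasDerivAt x).differentiableAt) (hd.intervalIntegrable _ _),
      hφ.eq_zero_of_nonpos le_rfl, sub_zero]
  have h := integral_inner_primitive (𝕜 := 𝕜) (f := fun s => _root_.deriv φ s • e) hb
    ((hd.smul continuous_const).intervalIntegrable _ _) hg
  have hend : φ (b + 1) = 0 := image_eq_zero_of_notMem_tsupport fun h' => by
    linarith [(hsupp h').2]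
  simp only [hφe, hend, zero_smul, inner_zero_left, inner_real_smul_left] at h
  rw [inner_neg_right]
  simp only [intervalIntegral.integral_of_le hb] at h ⊢
  rw [← integral_inner, ← integral_inner]
  · simp only [inner_real_smul_right]
    linear_combination h
  · exact IntegrableOn.continuousOn_smul_of_subset hφ.contDiff.continuous.continuousOn
      ((intervalIntegrable_iff_integrableOn_Ioc_of_le hb).1 hg) isCompact_Icc measurableSet_Ioc
      Ioc_subset_Icc_self
  · exact ((hd.continuousOn.smul hG).integrableOn_Icc).mono_set Ioc_subset_Icc_self

/-- Subtracting the primitive of `g` leaves a function with zero weak derivative, hence a constant.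
This provides the continuous representative. -/
theorem IsWeakDeriv.exists_ae_eq_primitive {f g : State 𝕜 d} (h : IsWeakDeriv f g) :
    ∃ c, ∀ᵐ x ∂halfLine, f x = c + ∫ s in 0..x, g s := by
  have hG : LocallyIntegrable (fun x => ∫ s in 0..x, g s) halfLine :=
    (locallyIntegrableOn_iff_locallyIntegrable_restrict isClosed_Ici).1
      ((continuousOn_primitive_state g).locallyIntegrableOn measurableSet_Ici)
  obtain ⟨c, hc⟩ := exists_ae_eq_const ((locallyIntegrable_state f).sub hG) fun φ hφ => by
    simp only [Pi.sub_apply, smul_sub]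
    rw [integral_sub (hφ.deriv.integrable_smul (locallyIntegrable_state f))
      (hφ.deriv.integrable_smul hG), hφ.integral_deriv_smul_primitive,
      h φ hφ.contDiff hφ.hasCompactSupport hφ.tsupport_subset, sub_self]
  exact ⟨c, hc.mono fun x hx => sub_eq_iff_eq_add.1 hx⟩

theorem IsWeakDeriv.exists_hasBoundaryValue {f g : State 𝕜 d} (h : IsWeakDeriv f g) :
    ∃ v, HasBoundaryValue f v := by
  obtain ⟨c, hc⟩ := h.exists_ae_eq_primitive
  exact ⟨c, _, continuousOn_const.add (continuousOn_primitive_state g), hc, by simp⟩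

/-- Continuous functions that agree almost everywhere on `[0, ∞)` agree at `0` too, which identifies
the constant as `v`. -/
theorem IsWeakDeriv.ae_eq_primitive {f g : State 𝕜 d} (h : IsWeakDeriv f g)
    {v : EuclideanSpace 𝕜 (Fin d)} (hv : HasBoundaryValue f v) :
    ∀ᵐ x ∂halfLine, f x = v + ∫ s in 0..x, g s := by
  obtain ⟨c, hc⟩ := h.exists_ae_eq_primitive
  obtain ⟨u, hu, hfu, rfl⟩ := hv
  have heq : EqOn u (fun x => c + ∫ s in 0..x, g s) (Ici 0) := by
    refine Measure.eqOn_of_ae_eq (μ := volume) ?_ hu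
      (continuousOn_const.add (continuousOn_primitive_state g)) ?_
    · filter_upwards [hc, hfu] with x h1 h2
      rw [← h1, h2]
    · rw [interior_Ici, closure_Ioi]
  have h0 : u 0 = c := by simpa using heq self_mem_Ici
  rwa [h0]

theorem integrable_inner_state (f g : State 𝕜 d) :
    Integrable (fun x => inner 𝕜 (f x) (g x)) halfLine :=
  L2.integrable_inner f g

/-- Green's formula on the half-line. -/
theorem IsWeakDeriv.inner_add_inner {f f' g g' : State 𝕜 d} {v w : EuclideanSpace 𝕜 (Fin d)}
    (hf : IsWeakDeriv f f') (hv : HasBoundaryValue f v) (hg : IsWeakDeriv g g')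
    (hw : HasBoundaryValue g w) :
    inner 𝕜 f' g + inner 𝕜 f g' = - inner 𝕜 v w := by
  set F : ℝ → EuclideanSpace 𝕜 (Fin d) := fun x => v + ∫ s in 0..x, f' s with hF
  set H : ℝ → EuclideanSpace 𝕜 (Fin d) := fun x => w + ∫ s in 0..x, g' s with hH
  have hfF := hf.ae_eq_primitive hv
  have hgH := hg.ae_eq_primitive hw
  have h1 : Integrable (fun x => inner 𝕜 (F x) (g' x) + inner 𝕜 (f' x) (H x)) halfLine := by
    refine ((integrable_inner_state f g').add (integrable_inner_state f' g)).congr ?_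
    filter_upwards [hfF, hgH] with x h1 h2
    rw [Pi.add_apply, h1, h2]
  have h2 : Integrable (fun x => inner 𝕜 (F x) (H x)) halfLine := by
    refine (integrable_inner_state f g).congr ?_
    filter_upwards [hfF, hgH] with x h1 h2
    rw [h1, h2]
  have hsum : inner 𝕜 f' g + inner 𝕜 f g' =
      ∫ x in Ioi 0, (inner 𝕜 (F x) (g' x) + inner 𝕜 (f' x) (H x)) := by
    rw [L2.inner_def, L2.inner_def, add_comm,
      ← integral_add (integrable_inner_state f g') (integrable_inner_state f' g),
      ← integral_Ici_eq_integral_Ioi]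
    refine integral_congr_ae ?_
    filter_upwards [hfF, hgH] with x h1 h2
    rw [h1, h2]
  have hlim := intervalIntegral_tendsto_integral_Ioi 0
    (h1.mono_measure (Measure.restrict_mono Ioi_subset_Ici_self le_rfl)) tendsto_id
  rw [← hsum] at hlim
  have hlim2 : Tendsto (fun b => inner 𝕜 (F b) (H b)) atTop
      (𝓝 (inner 𝕜 f' g + inner 𝕜 f g' + inner 𝕜 v w)) := by
    refine (hlim.add_const (inner 𝕜 v w)).congr' ?_
    filter_upwards [eventually_ge_atTop 0] with b hb
    rw [id, integral_inner_add_primitive hb (intervalIntegrable_state f' hb)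
      (intervalIntegrable_state g' hb), sub_add_cancel]
  -- The product of the representatives is integrable and has a limit at infinity; a nonzero limit
  -- would contradict integrability.
  have hzero := IntegrableAtFilter.eq_zero_of_tendsto (μ := volume)
    ⟨Ici 0, Ici_mem_atTop 0, h2⟩ (fun s hs => by
      obtain ⟨b, hb⟩ := mem_atTop_sets.1 hs
      rw [← top_le_iff, ← Real.volume_Ici (a := b)]
      exact measure_mono hb) hlim2
  exact eq_neg_of_add_eq_zero_left hzero

end WeakDerivative

/-! ### Linear algebra of the boundary condition -/

section Matrices

variable {𝕜 : Type*} [RCLike 𝕜]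

theorem star_dotProduct_realDiag_mulVec {n : ℕ} (a : Fin n → ℝ) (x : Fin n → 𝕜) :
    star x ⬝ᵥ (realDiag 𝕜 a *ᵥ x) = ((∑ i, a i * ‖x i‖ ^ 2 : ℝ) : 𝕜) := by
  rw [realDiag, dotProduct, RCLike.ofReal_sum]
  refine Finset.sum_congr rfl fun i _ => ?_
  rw [Matrix.mulVec_diagonal, Pi.star_apply, RCLike.star_def, RCLike.ofReal_mul,
    RCLike.ofReal_pow, ← RCLike.conj_mul]
  ring

theorem eq_zero_of_realDiag_pos {n : ℕ} {a : Fin n → ℝ} (ha : ∀ i, 0 < a i) {x : Fin n → 𝕜}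
    (h : star x ⬝ᵥ (realDiag 𝕜 a *ᵥ x) = 0) : x = 0 := by
  rw [star_dotProduct_realDiag_mulVec, RCLike.ofReal_eq_zero,
    Finset.sum_eq_zero_iff_of_nonneg fun i _ => mul_nonneg (ha i).le (sq_nonneg _)] at h
  funext i
  simpa [(ha i).ne'] using h i (Finset.mem_univ i)

theorem eq_zero_of_realDiag_neg {n : ℕ} {a : Fin n → ℝ} (ha : ∀ i, a i < 0) {x : Fin n → 𝕜}
    (h : star x ⬝ᵥ (realDiag 𝕜 a *ᵥ x) = 0) : x = 0 := by
  refine eq_zero_of_realDiag_pos (a := fun i => -a i) (fun i => neg_pos.2 (ha i)) ?_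
  rw [star_dotProduct_realDiag_mulVec] at h ⊢
  simpa using h

theorem realDiag_conjTranspose {n : ℕ} (a : Fin n → ℝ) : (realDiag 𝕜 a)ᴴ = realDiag 𝕜 a := by
  rw [realDiag, Matrix.diagonal_conjTranspose]
  congr 1
  funext i
  simp

/-- A Hermitian matrix with vanishing quadratic form is zero. -/
theorem eq_zero_of_isHermitian {n : Type*} [Fintype n] [DecidableEq n] {N : Matrix n n 𝕜}
    (hN : N.IsHermitian) (h : ∀ x : n → 𝕜, star x ⬝ᵥ (N *ᵥ x) = 0) : N = 0 := by
  have hs := Matrix.isSymmetric_toEuclideanLin_iff.2 hN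
  rw [← map_eq_zero_iff (Matrix.toEuclideanLin (𝕜 := 𝕜)) (LinearEquiv.injective _),
    ← hs.inner_map_self_eq_zero]
  intro x
  rw [hs, EuclideanSpace.inner_eq_star_dotProduct, dotProduct_comm]
  exact h _

variable {d n₁ n₂ : ℕ} {P : Matrix (Fin d) (Fin d) 𝕜}
  {S : Matrix (Fin n₁ ⊕ Fin n₂) (Fin d) 𝕜} {l : Fin n₁ → ℝ} {θ : Fin n₂ → ℝ}

namespace IsDiagonalization

theorem add_eq (hS : IsDiagonalization P S l θ) : n₁ + n₂ = d := by
  simpa using Matrix.square_of_invertible S Sᴴ hS.mul_star_self hS.star_mul_self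

/-- Every vector is given by its components in the two eigenspaces. -/
theorem exists_eq (hS : IsDiagonalization P S l θ) (y : Fin d → 𝕜) :
    ∃ p q, y = Sᴴ *ᵥ Sum.elim p q := by
  refine ⟨(S *ᵥ y) ∘ Sum.inl, (S *ᵥ y) ∘ Sum.inr, ?_⟩
  rw [Sum.elim_comp_inl_inr, Matrix.mulVec_mulVec, hS.star_mul_self, Matrix.one_mulVec]

theorem mulVec_conjTranspose (hS : IsDiagonalization P S l θ) (x : Fin n₁ ⊕ Fin n₂ → 𝕜) :
    S *ᵥ (Sᴴ *ᵥ x) = x := by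
  rw [Matrix.mulVec_mulVec, hS.mul_star_self, Matrix.one_mulVec]

/-- In the coordinates given by `S` the form splits into a positive and a negative definite part;
every signature argument below rests on this. -/
theorem form_eq (hS : IsDiagonalization P S l θ) (p r : Fin n₁ → 𝕜) (q s : Fin n₂ → 𝕜) :
    star (Sᴴ *ᵥ Sum.elim p q) ⬝ᵥ (P *ᵥ (Sᴴ *ᵥ Sum.elim r s)) =
      star p ⬝ᵥ (realDiag 𝕜 l *ᵥ r) + star q ⬝ᵥ (realDiag 𝕜 θ *ᵥ s) := by
  rw [hS.eq, ← Matrix.mulVec_mulVec, hS.mulVec_conjTranspose, ← Matrix.mulVec_mulVec,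
    Matrix.dotProduct_mulVec, ← Matrix.star_mulVec, hS.mulVec_conjTranspose,
    Matrix.fromBlocks_mulVec]
  simp [dotProduct]

/-- An isotropic vector with one eigenspace component equal to zero lies in a definite subspace,
hence is zero. So the projection of `ker W` to either eigenspace is injective. -/
theorem finrank_ker_le {k : ℕ} (hS : IsDiagonalization P S l θ) (W : Matrix (Fin k) (Fin d) 𝕜)
    (h : ∀ y : Fin d → 𝕜, W *ᵥ y = 0 → star y ⬝ᵥ (P *ᵥ y) = 0) :
    Module.finrank 𝕜 W.mulVecLin.ker ≤ n₁ ∧ Module.finrank 𝕜 W.mulVecLin.ker ≤ n₂ := by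
  have hker : ∀ y ∈ W.mulVecLin.ker, star y ⬝ᵥ (P *ᵥ y) = 0 := fun y hy => h y hy
  constructor
  · let f : W.mulVecLin.ker →ₗ[𝕜] (Fin n₁ → 𝕜) :=
      (LinearMap.funLeft 𝕜 𝕜 Sum.inl ∘ₗ S.mulVecLin) ∘ₗ W.mulVecLin.ker.subtype
    have hf : Function.Injective f := by
      rw [← LinearMap.ker_eq_bot, LinearMap.ker_eq_bot']
      rintro ⟨y, hy⟩ h0
      obtain ⟨p, q, rfl⟩ := hS.exists_eq y
      have hp : p = 0 := by
        funext i
        have := congrFun h0 i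
        simpa [f, LinearMap.funLeft_apply, hS.mulVec_conjTranspose] using this
      have h1 := hker _ hy
      rw [hS.form_eq, hp] at h1
      have hq : q = 0 := eq_zero_of_realDiag_neg hS.neg (by simpa using h1)
      simp [hp, hq]
    simpa using LinearMap.finrank_le_finrank_of_injective hf
  · let f : W.mulVecLin.ker →ₗ[𝕜] (Fin n₂ → 𝕜) :=
      (LinearMap.funLeft 𝕜 𝕜 Sum.inr ∘ₗ S.mulVecLin) ∘ₗ W.mulVecLin.ker.subtype
    have hf : Function.Injective f := by
      rw [← LinearMap.ker_eq_bot, LinearMap.ker_eq_bot']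
      rintro ⟨y, hy⟩ h0
      obtain ⟨p, q, rfl⟩ := hS.exists_eq y
      have hq : q = 0 := by
        funext i
        have := congrFun h0 i
        simpa [f, LinearMap.funLeft_apply, hS.mulVec_conjTranspose] using this
      have h1 := hker _ hy
      rw [hS.form_eq, hq] at h1
      have hp : p = 0 := eq_zero_of_realDiag_pos hS.pos (by simpa using h1)
      simp [hp, hq]
    simpa using LinearMap.finrank_le_finrank_of_injective hf

/-- Isotropy gives `d - k ≤ n₁` and `d - k ≤ n₂`, that is `n₂ ≤ k` and `n₁ ≤ k`; the assumed bound
on `k` closes the circle. -/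
theorem dims_eq {k : ℕ} (hS : IsDiagonalization P S l θ) {W : Matrix (Fin k) (Fin d) 𝕜}
    (hk : k ≤ min n₁ n₂) (hW : W.rank = k)
    (h : ∀ y : Fin d → 𝕜, W *ᵥ y = 0 → star y ⬝ᵥ (P *ᵥ y) = 0) : n₁ = k ∧ n₁ = n₂ := by
  have h1 := hS.finrank_ker_le W h
  have h2 := LinearMap.finrank_range_add_finrank_ker W.mulVecLin
  have h3 := hS.add_eq
  rw [Module.finrank_fin_fun] at h2
  change W.rank + _ = _ at h2
  omega

end IsDiagonalization

section Square

variable {n : ℕ} {S : Matrix (Fin n ⊕ Fin n) (Fin d) 𝕜} {l θ : Fin n → ℝ}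
  {W : Matrix (Fin n) (Fin d) 𝕜} {U₁ U₂ : Matrix (Fin n) (Fin n) 𝕜}

theorem IsDiagonalization.mulVec_eq (hS : IsDiagonalization P S l θ)
    (hW : W = Matrix.fromCols U₁ U₂ * S) (p q : Fin n → 𝕜) :
    W *ᵥ (Sᴴ *ᵥ Sum.elim p q) = U₁ *ᵥ p + U₂ *ᵥ q := by
  rw [hW, ← Matrix.mulVec_mulVec, hS.mulVec_conjTranspose, Matrix.fromCols_mulVec]
  simp

theorem IsDiagonalization.mulVec_eq_zero_iff (hS : IsDiagonalization P S l θ)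
    (hW : W = Matrix.fromCols U₁ U₂ * S) (hU₂ : IsUnit U₂) (p q : Fin n → 𝕜) :
    W *ᵥ (Sᴴ *ᵥ Sum.elim p q) = 0 ↔ q = -((U₂⁻¹ * U₁) *ᵥ p) := by
  have hdet : IsUnit U₂.det := (Matrix.isUnit_iff_isUnit_det _).1 hU₂
  rw [hS.mulVec_eq hW]
  constructor
  · intro h
    have h1 := congrArg (U₂⁻¹ *ᵥ ·) h
    simp only [Matrix.mulVec_add, Matrix.mulVec_mulVec, Matrix.nonsing_inv_mul _ hdet,
      Matrix.one_mulVec, Matrix.mulVec_zero] at h1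
    exact eq_neg_of_add_eq_zero_right h1
  · rintro rfl
    rw [Matrix.mulVec_neg, Matrix.mulVec_mulVec, Matrix.mul_nonsing_inv_cancel_left _ _ hdet,
      add_neg_cancel]

/-- A kernel vector of `U₁` or `U₂` gives an isotropic vector in a single definite eigenspace, so
both blocks are invertible. On the graph `q = -U₂⁻¹U₁p` the form is the quadratic form of the
displayed Hermitian matrix, which must therefore be zero. -/
theorem IsDiagonalization.exists_blocks (hS : IsDiagonalization P S l θ)
    (h : ∀ y : Fin d → 𝕜, W *ᵥ y = 0 → star y ⬝ᵥ (P *ᵥ y) = 0) :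
    ∃ U₁ U₂ : Matrix (Fin n) (Fin n) 𝕜, IsUnit U₁ ∧ IsUnit U₂ ∧
      W = Matrix.fromCols U₁ U₂ * S ∧
      realDiag 𝕜 l + U₁ᴴ * (U₂⁻¹)ᴴ * realDiag 𝕜 θ * U₂⁻¹ * U₁ = 0 := by
  set U₁ := (W * Sᴴ).toCols₁ with hU₁
  set U₂ := (W * Sᴴ).toCols₂ with hU₂
  have hW : W = Matrix.fromCols U₁ U₂ * S := by
    rw [hU₁, hU₂, Matrix.fromCols_toCols, Matrix.mul_assoc, hS.star_mul_self, Matrix.mul_one]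
  have hform : ∀ p q : Fin n → 𝕜, U₁ *ᵥ p + U₂ *ᵥ q = 0 →
      star p ⬝ᵥ (realDiag 𝕜 l *ᵥ p) + star q ⬝ᵥ (realDiag 𝕜 θ *ᵥ q) = 0 := fun p q hpq => by
    rw [← hS.form_eq]
    exact h _ (by rw [hS.mulVec_eq hW, hpq])
  have h1 : IsUnit U₁ := by
    rw [← Matrix.mulVec_injective_iff_isUnit, ← Matrix.coe_mulVecLin, ← LinearMap.ker_eq_bot,
      LinearMap.ker_eq_bot']
    intro p hp
    have hp' : U₁ *ᵥ p = 0 := hp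
    have := hform p 0 (by simp [hp'])
    exact eq_zero_of_realDiag_pos hS.pos (by simpa using this)
  have h2 : IsUnit U₂ := by
    rw [← Matrix.mulVec_injective_iff_isUnit, ← Matrix.coe_mulVecLin, ← LinearMap.ker_eq_bot,
      LinearMap.ker_eq_bot']
    intro q hq
    have hq' : U₂ *ᵥ q = 0 := hq
    have := hform 0 q (by simp [hq'])
    exact eq_zero_of_realDiag_neg hS.neg (by simpa using this)
  refine ⟨U₁, U₂, h1, h2, hW, eq_zero_of_isHermitian ?_ fun p => ?_⟩
  · simp only [Matrix.IsHermitian, Matrix.conjTranspose_add, Matrix.conjTranspose_mul,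
      realDiag_conjTranspose, Matrix.conjTranspose_conjTranspose, Matrix.mul_assoc]
  · have h3 := hform p (-((U₂⁻¹ * U₁) *ᵥ p))
      (by rw [← hS.mulVec_eq hW, hS.mulVec_eq_zero_iff hW h2])
    rw [Matrix.mulVec_neg, star_neg, neg_dotProduct_neg, Matrix.star_mulVec,
      ← Matrix.dotProduct_mulVec, ← dotProduct_add, Matrix.mulVec_mulVec, Matrix.mulVec_mulVec,
      ← Matrix.add_mulVec] at h3
    simpa only [Matrix.conjTranspose_mul, Matrix.mul_assoc] using h3

/-- The kernel of `W` is its own orthogonal complement for the form of `P`. -/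
theorem IsDiagonalization.mulVec_eq_zero_iff_forall (hS : IsDiagonalization P S l θ)
    (hW : W = Matrix.fromCols U₁ U₂ * S) (hU₁ : IsUnit U₁) (hU₂ : IsUnit U₂)
    (h : realDiag 𝕜 l + U₁ᴴ * (U₂⁻¹)ᴴ * realDiag 𝕜 θ * U₂⁻¹ * U₁ = 0) (y : Fin d → 𝕜) :
    W *ᵥ y = 0 ↔ ∀ z, W *ᵥ z = 0 → star z ⬝ᵥ (P *ᵥ y) = 0 := by
  set V := U₂⁻¹ * U₁ with hV
  have hVunit : IsUnit V := ((Matrix.isUnit_nonsing_inv_iff).2 hU₂).mul hU₁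
  have hl : realDiag 𝕜 l = -(Vᴴ * realDiag 𝕜 θ * V) := by
    rw [eq_neg_iff_add_eq_zero, ← h, hV, Matrix.conjTranspose_mul]
    simp only [Matrix.mul_assoc]
  -- The matrix identity replaces `Λ` by `-VᴴΘV`, so pairing with a kernel vector sees only `V p +
  -- q`, the quantity that vanishes on `ker W`.
  have hform : ∀ a p q : Fin n → 𝕜,
      star (Sᴴ *ᵥ Sum.elim a (-(V *ᵥ a))) ⬝ᵥ (P *ᵥ (Sᴴ *ᵥ Sum.elim p q)) =
        -(star (V *ᵥ a) ⬝ᵥ (realDiag 𝕜 θ *ᵥ (V *ᵥ p + q))) := by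
    intro a p q
    have h1 : star a ⬝ᵥ (Vᴴ *ᵥ (realDiag 𝕜 θ *ᵥ (V *ᵥ p))) =
        star (V *ᵥ a) ⬝ᵥ (realDiag 𝕜 θ *ᵥ (V *ᵥ p)) := by
      rw [Matrix.dotProduct_mulVec, Matrix.star_mulVec]
    rw [hS.form_eq, hl, star_neg, neg_dotProduct, Matrix.neg_mulVec, dotProduct_neg,
      ← Matrix.mulVec_mulVec, ← Matrix.mulVec_mulVec, h1, Matrix.mulVec_add, dotProduct_add,
      neg_add]
  obtain ⟨p, q, rfl⟩ := hS.exists_eq y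
  rw [hS.mulVec_eq_zero_iff hW hU₂]
  constructor
  · rintro rfl z hz
    obtain ⟨a, b, rfl⟩ := hS.exists_eq z
    rw [hS.mulVec_eq_zero_iff hW hU₂] at hz
    rw [hz, hform]
    simp [hV]
  · intro hall
    -- Surjectivity of `V` allows testing `V p + q` against itself, and `Θ` is definite.
    obtain ⟨a, ha⟩ := (Matrix.mulVec_surjective_iff_isUnit.2 hVunit) (V *ᵥ p + q)
    have h1 := hall (Sᴴ *ᵥ Sum.elim a (-(V *ᵥ a))) ((hS.mulVec_eq_zero_iff hW hU₂ _ _).2 rfl)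
    have ha' : V *ᵥ a = V *ᵥ p + q := ha
    rw [hform, ha', neg_eq_zero] at h1
    exact eq_neg_of_add_eq_zero_right (eq_zero_of_realDiag_neg hS.neg h1)

end Square

end Matrices

/-! ### Multiplication operators on the state space -/

section Operators

variable {𝕜 : Type*} [RCLike 𝕜] {m d : ℕ}

/-- A matrix as a bounded operator between Euclidean spaces. -/
def matCLM (M : Matrix (Fin m) (Fin d) 𝕜) :
    EuclideanSpace 𝕜 (Fin d) →L[𝕜] EuclideanSpace 𝕜 (Fin m) :=
  LinearMap.toContinuousLinearMap (Matrix.toEuclideanLin M)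

theorem matCLM_apply (M : Matrix (Fin m) (Fin d) 𝕜) (v : EuclideanSpace 𝕜 (Fin d)) :
    matCLM M v = act M v := rfl

theorem act_eq_zero_iff {M : Matrix (Fin m) (Fin d) 𝕜} {v : EuclideanSpace 𝕜 (Fin d)} :
    act M v = 0 ↔ M *ᵥ WithLp.ofLp v = 0 :=
  WithLp.toLp_eq_zero 2

theorem inner_act_right (M : Matrix (Fin d) (Fin d) 𝕜) (v w : EuclideanSpace 𝕜 (Fin d)) :
    inner 𝕜 v (act M w) = star (WithLp.ofLp v) ⬝ᵥ (M *ᵥ WithLp.ofLp w) := by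
  rw [EuclideanSpace.inner_eq_star_dotProduct, dotProduct_comm]
  rfl

theorem inner_act_left (M : Matrix (Fin d) (Fin d) 𝕜) (v w : EuclideanSpace 𝕜 (Fin d)) :
    inner 𝕜 (act M v) w = inner 𝕜 v (act Mᴴ w) := by
  rw [inner_act_right, EuclideanSpace.inner_eq_star_dotProduct, dotProduct_comm, act,
    Matrix.star_mulVec, Matrix.dotProduct_mulVec]

theorem act_mul (M N : Matrix (Fin d) (Fin d) 𝕜) (v : EuclideanSpace 𝕜 (Fin d)) :
    act (M * N) v = act M (act N v) := by
  rw [act, act, act, Matrix.mulVec_mulVec]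

theorem act_one (v : EuclideanSpace 𝕜 (Fin d)) : act (1 : Matrix (Fin d) (Fin d) 𝕜) v = v := by
  rw [act, Matrix.one_mulVec]

theorem act_add_left (M N : Matrix (Fin d) (Fin d) 𝕜) (v : EuclideanSpace 𝕜 (Fin d)) :
    act (M + N) v = act M v + act N v := by
  rw [act, Matrix.add_mulVec]
  rfl

/-- Pointwise multiplication by a constant matrix. -/
def opState (M : Matrix (Fin d) (Fin d) 𝕜) : State 𝕜 d →L[𝕜] State 𝕜 d :=
  (matCLM M).compLpL 2 halfLine

theorem coeFn_opState (M : Matrix (Fin d) (Fin d) 𝕜) (f : State 𝕜 d) :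
    ∀ᵐ ζ ∂halfLine, opState M f ζ = act M (f ζ) :=
  (matCLM M).coeFn_compLpL f

theorem inner_opState_left (M : Matrix (Fin d) (Fin d) 𝕜) (f g : State 𝕜 d) :
    inner 𝕜 (opState M f) g = inner 𝕜 f (opState Mᴴ g) := by
  rw [L2.inner_def, L2.inner_def]
  refine integral_congr_ae ?_
  filter_upwards [coeFn_opState M f, coeFn_opState Mᴴ g] with ζ h1 h2
  rw [h1, h2, inner_act_left]

theorem opState_add (M N : Matrix (Fin d) (Fin d) 𝕜) (f : State 𝕜 d) :
    opState (M + N) f = opState M f + opState N f := by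
  refine Lp.ext ?_
  filter_upwards [coeFn_opState (M + N) f, coeFn_opState M f, coeFn_opState N f,
    Lp.coeFn_add (opState M f) (opState N f)] with ζ h1 h2 h3 h4
  rw [h1, h4, Pi.add_apply, h2, h3, act_add_left]

theorem opState_mul (M N : Matrix (Fin d) (Fin d) 𝕜) (f : State 𝕜 d) :
    opState (M * N) f = opState M (opState N f) := by
  refine Lp.ext ?_
  filter_upwards [coeFn_opState (M * N) f, coeFn_opState M (opState N f), coeFn_opState N f]
    with ζ h1 h2 h3
  rw [h1, h2, h3, act_mul]

theorem opState_one (f : State 𝕜 d) : opState 1 f = f := by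
  refine Lp.ext ?_
  filter_upwards [coeFn_opState 1 f] with ζ h
  rw [h, act_one]

theorem opState_zero (f : State 𝕜 d) : opState 0 f = 0 := by
  have h := opState_add (0 : Matrix (Fin d) (Fin d) 𝕜) 0 f
  rw [add_zero] at h
  exact left_eq_add.1 h

/-- Bounded matrix functions act on the state space by multiplication. -/
theorem exists_mulOperator {ℋ : ℝ → Matrix (Fin d) (Fin d) 𝕜}
    (hℋ : ∀ i j, MemLp (fun ζ => ℋ ζ i j) ⊤ halfLine) :
    ∃ H : State 𝕜 d →L[𝕜] State 𝕜 d, ∀ f, ∀ᵐ ζ ∂halfLine, H f ζ = act (ℋ ζ) (f ζ) := by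
  -- Expanding in matrix units transfers measurability and essential boundedness from the entries to
  -- the operator-valued function.
  have hsum : ∀ M : Matrix (Fin d) (Fin d) 𝕜,
      matCLM M = ∑ i, ∑ j, M i j • matCLM (Matrix.single i j 1) := by
    intro M
    ext1 v
    simp only [sum_apply, smul_apply, matCLM_apply, act]
    rw [← WithLp.ofLp_injective 2 |>.eq_iff]
    conv_lhs => rw [Matrix.matrix_eq_sum_single M]
    simp [Matrix.sum_mulVec, ← Matrix.smul_mulVec, Matrix.smul_single]
  have hterm : ∀ i j, MemLp (fun ζ => ℋ ζ i j • matCLM (Matrix.single i j (1 : 𝕜))) ⊤ halfLine :=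
    fun i j => (ContinuousLinearMap.toSpanSingleton 𝕜
      (matCLM (Matrix.single i j (1 : 𝕜)))).comp_memLp' (hℋ i j)
  have hrow : ∀ i, MemLp (fun ζ => ∑ j, ℋ ζ i j • matCLM (Matrix.single i j (1 : 𝕜))) ⊤ halfLine :=
    fun i => memLp_finsetSum (f := fun j ζ => ℋ ζ i j • matCLM (Matrix.single i j (1 : 𝕜)))
      Finset.univ fun j _ => hterm i j
  have hmem : MemLp (fun ζ => matCLM (ℋ ζ)) ⊤ halfLine := by
    have h := memLp_finsetSum
      (f := fun i ζ => ∑ j, ℋ ζ i j • matCLM (Matrix.single i j (1 : 𝕜)))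
      Finset.univ fun i _ => hrow i
    rwa [← funext fun ζ => hsum (ℋ ζ)] at h
  refine ⟨(ContinuousLinearMap.id 𝕜 _).holderL halfLine ⊤ 2 2 (hmem.toLp _), fun f => ?_⟩
  filter_upwards [(ContinuousLinearMap.id 𝕜 _).coeFn_holder (r := 2) (hmem.toLp _) f,
    hmem.coeFn_toLp] with ζ h1 h2
  refine h1.trans ?_
  rw [h2]
  rfl

theorem energyInner_eq {ℋ : ℝ → Matrix (Fin d) (Fin d) 𝕜} {H : State 𝕜 d →L[𝕜] State 𝕜 d}
    (hH : ∀ f, ∀ᵐ ζ ∂halfLine, H f ζ = act (ℋ ζ) (f ζ)) (x y : State 𝕜 d) :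
    energyInner ℋ x y = inner 𝕜 x (H y) := by
  rw [L2.inner_def]
  refine integral_congr_ae ?_
  filter_upwards [hH y] with ζ h
  rw [h]

open scoped ComplexOrder in
/-- The multiplication operator of a bounded, positive definite, boundedly invertible matrix
function is symmetric, coercive and invertible. -/
theorem exists_energyOperator {ℋ : ℝ → Matrix (Fin d) (Fin d) 𝕜}
    (hpos : ∀ᵐ ζ ∂halfLine, (ℋ ζ).PosDef)
    (hℋ : ∀ i j, MemLp (fun ζ => ℋ ζ i j) ⊤ halfLine)
    (hℋinv : ∀ i j, MemLp (fun ζ => (ℋ ζ)⁻¹ i j) ⊤ halfLine) :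
    ∃ H K : State 𝕜 d →L[𝕜] State 𝕜 d, (∀ f, ∀ᵐ ζ ∂halfLine, H f ζ = act (ℋ ζ) (f ζ)) ∧
      (∀ f, H (K f) = f) ∧ (∀ f g, inner 𝕜 (H f) g = inner 𝕜 f (H g)) ∧
      ∃ c > 0, ∀ f, c * ‖f‖ ^ 2 ≤ RCLike.re (inner 𝕜 f (H f)) := by
  obtain ⟨H, hH⟩ := exists_mulOperator hℋ
  obtain ⟨K, hK⟩ := exists_mulOperator hℋinv
  have hHK : ∀ f, H (K f) = f := fun f => by
    refine Lp.ext ?_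
    filter_upwards [hH (K f), hK f, hpos] with ζ h1 h2 h3
    rw [h1, h2, ← act_mul, Matrix.mul_nonsing_inv _ ((Matrix.isUnit_iff_isUnit_det _).1 h3.isUnit),
      act_one]
  have hsymm : ∀ f g, inner 𝕜 (H f) g = inner 𝕜 f (H g) := fun f g => by
    rw [L2.inner_def, L2.inner_def]
    refine integral_congr_ae ?_
    filter_upwards [hH f, hH g, hpos] with ζ h1 h2 h3
    rw [h1, h2, inner_act_left, h3.isHermitian]
  have hnonneg : ∀ f, 0 ≤ RCLike.re (inner 𝕜 f (H f)) := fun f => by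
    rw [L2.inner_def, ← integral_re (L2.integrable_inner f (H f))]
    refine integral_nonneg_of_ae ?_
    filter_upwards [hH f, hpos] with ζ h1 h2
    rw [h1, inner_act_right]
    exact h2.posSemidef.re_dotProduct_nonneg _
  exact ⟨H, K, hH, hHK, hsymm, exists_coercive hsymm hnonneg hHK⟩

end Operators

/-! ### The boundary form and skew-adjointness of `A` -/

section Graph

variable {𝕜 : Type*} [RCLike 𝕜] {d k : ℕ}

theorem matCLM_real_smul (M : Matrix (Fin d) (Fin d) 𝕜) (r : ℝ) (v : EuclideanSpace 𝕜 (Fin d)) :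
    matCLM M (r • v) = r • matCLM M v := by
  rw [RCLike.real_smul_eq_coe_smul (K := 𝕜), map_smul, ← RCLike.real_smul_eq_coe_smul]

theorem IsTest.integral_smul_opState {φ : ℝ → ℝ} (hφ : IsTest φ) (M : Matrix (Fin d) (Fin d) 𝕜)
    (f : State 𝕜 d) :
    ∫ ζ, φ ζ • opState M f ζ ∂halfLine = matCLM M (∫ ζ, φ ζ • f ζ ∂halfLine) := by
  rw [← ContinuousLinearMap.integral_comp_comm _
    (hφ.integrable_smul (locallyIntegrable_state f))]
  refine integral_congr_ae ?_
  filter_upwards [coeFn_opState M f] with ζ h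
  rw [h, matCLM_real_smul, matCLM_apply]

theorem IsWeakDeriv.opState {f g : State 𝕜 d} (h : IsWeakDeriv f g)
    (M : Matrix (Fin d) (Fin d) 𝕜) : IsWeakDeriv (opState M f) (opState M g) := by
  intro φ h1 h2 h3
  have hφ : IsTest φ := ⟨h1, h2, h3⟩
  rw [hφ.deriv.integral_smul_opState, hφ.integral_smul_opState, h φ h1 h2 h3, map_neg]

theorem HasBoundaryValue.opState {f : State 𝕜 d} {v : EuclideanSpace 𝕜 (Fin d)}
    (h : HasBoundaryValue f v) (M : Matrix (Fin d) (Fin d) 𝕜) :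
    HasBoundaryValue (opState M f) (act M v) := by
  obtain ⟨u, hu, hfu, rfl⟩ := h
  refine ⟨fun ζ => matCLM M (u ζ), (matCLM M).continuous.comp_continuousOn hu, ?_, rfl⟩
  filter_upwards [hfu, coeFn_opState M f] with ζ h1 h2
  rw [h2, h1, matCLM_apply]

variable {P₀ P₁ : Matrix (Fin d) (Fin d) 𝕜} {W : Matrix (Fin k) (Fin d) 𝕜}

theorem graphA_iff {x y : State 𝕜 d} : GraphA P₀ P₁ W x y ↔
    ∃ (x' : State 𝕜 d) (v : EuclideanSpace 𝕜 (Fin d)), IsWeakDeriv x x' ∧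
      HasBoundaryValue x v ∧ act W v = 0 ∧ y = opState P₀ x + opState P₁ x' := by
  refine exists_congr fun x' => exists_congr fun v => and_congr_right fun _ =>
    and_congr_right fun _ => and_congr_right fun _ => ?_
  have h : ∀ᵐ ζ ∂halfLine, (opState P₀ x + opState P₁ x' : State 𝕜 d) ζ =
      act P₀ (x ζ) + act P₁ (x' ζ) := by
    filter_upwards [coeFn_opState P₀ x, coeFn_opState P₁ x',
      Lp.coeFn_add (opState P₀ x) (opState P₁ x')] with ζ h1 h2 h3
    rw [h3, Pi.add_apply, h1, h2]
  constructor
  · intro hy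
    refine Lp.ext ?_
    filter_upwards [hy, h] with ζ h1 h2
    rw [h1, h2]
  · rintro rfl
    exact h

/-- The boundary form of the operator `x ↦ P₀ x + P₁ x'`. -/
theorem inner_add_inner_eq_boundary (hP₁ : P₁.IsHermitian) {x x' u u' : State 𝕜 d}
    {v w : EuclideanSpace 𝕜 (Fin d)} (hx : IsWeakDeriv x x') (hv : HasBoundaryValue x v)
    (hu : IsWeakDeriv u u') (hw : HasBoundaryValue u w) :
    inner 𝕜 (opState P₀ u + opState P₁ u') x + inner 𝕜 u (opState P₀ x + opState P₁ x') =
      inner 𝕜 (opState (P₀ + P₀ᴴ) u) x - inner 𝕜 w (act P₁ v) := by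
  have h1 := (hu.opState P₁).inner_add_inner (hw.opState P₁) hx hv
  have h2 := inner_opState_left P₁ u x'
  have h3 := inner_opState_left P₀ᴴ u x
  have h4 := inner_act_left P₁ w v
  rw [hP₁.eq] at h2 h4
  rw [Matrix.conjTranspose_conjTranspose] at h3
  rw [opState_add, inner_add_left, inner_add_left, inner_add_right]
  linear_combination h1 - h2 - h3 - h4

/-- The element `ζ ↦ η(ζ) e` of the state space. -/
def smulState {η : ℝ → ℝ} (hη : MemLp η 2 halfLine) (e : EuclideanSpace 𝕜 (Fin d)) :
    State 𝕜 d :=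
  ((hη.of_le_mul (c := ‖e‖) (hη.1.smul_const e) (Eventually.of_forall fun ζ => by
    rw [norm_smul, mul_comm])).toLp (fun ζ => η ζ • e))

theorem coeFn_smulState {η : ℝ → ℝ} (hη : MemLp η 2 halfLine) (e : EuclideanSpace 𝕜 (Fin d)) :
    ∀ᵐ ζ ∂halfLine, smulState hη e ζ = η ζ • e :=
  MemLp.coeFn_toLp _

theorem hasBoundaryValue_smulState {η : ℝ → ℝ} (hη : MemLp η 2 halfLine) (hc : Continuous η)
    (e : EuclideanSpace 𝕜 (Fin d)) : HasBoundaryValue (smulState hη e) (η 0 • e) :=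
  ⟨fun ζ => η ζ • e, (hc.smul continuous_const).continuousOn, coeFn_smulState hη e, rfl⟩

theorem IsTest.integral_smul_smul {φ : ℝ → ℝ} (hφ : IsTest φ) (β : ℝ → ℝ)
    (e : EuclideanSpace 𝕜 (Fin d)) :
    ∫ ζ, φ ζ • β ζ • e ∂halfLine = (∫ ζ, β ζ * φ ζ) • e := by
  rw [hφ.integral_halfLine, ← integral_smul_const]
  simp only [smul_smul, mul_comm]

theorem isWeakDeriv_smulState {η η' : ℝ → ℝ} (hη : MemLp η 2 halfLine)
    (hη' : MemLp η' 2 halfLine) (hd : ∀ x, HasDerivAt η (η' x) x) (hc : Continuous η')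
    (e : EuclideanSpace 𝕜 (Fin d)) : IsWeakDeriv (smulState hη e) (smulState hη' e) := by
  intro φ h1 h2 h3
  have hφ : IsTest φ := ⟨h1, h2, h3⟩
  have hηc : Continuous η := continuous_iff_continuousAt.2 fun x => (hd x).continuousAt
  have hcalc : ∀ (α β : ℝ → ℝ) (_ : IsTest α) (hβ : MemLp β 2 halfLine),
      ∫ ζ, α ζ • smulState hβ e ζ ∂halfLine = (∫ ζ, β ζ * α ζ) • e := by
    intro α β hα hβ
    rw [← hα.integral_smul_smul]
    refine integral_congr_ae ?_
    filter_upwards [coeFn_smulState hβ e] with ζ h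
    rw [h]
  have hint : ∀ α β : ℝ → ℝ, IsTest α → Continuous β → Integrable (β * α) := fun α β hα hβ =>
    (hβ.mul hα.contDiff.continuous).integrable_of_hasCompactSupport hα.hasCompactSupport.mul_left
  rw [hcalc _ _ hφ.deriv, hcalc _ _ hφ, ← neg_smul,
    integral_mul_deriv_eq_deriv_mul_of_integrable (fun x _ => hd x) (fun x _ => hφ.hasDerivAt x)
      (hint _ _ hφ.deriv hηc) (hint _ _ hφ hc) (hint _ _ hφ hηc)]

theorem IsTest.memLp {φ : ℝ → ℝ} (hφ : IsTest φ) : MemLp φ 2 halfLine :=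
  (hφ.contDiff.continuous.memLp_of_hasCompactSupport hφ.hasCompactSupport).restrict _

theorem memLp_exp_neg : MemLp (fun ζ : ℝ => Real.exp (-ζ)) 2 halfLine := by
  rw [memLp_two_iff_integrable_sq (by fun_prop), halfLine, ← restrict_Ioi_eq_restrict_Ici]
  refine (exp_neg_integrableOn_Ioi 0 two_pos).congr (Eventually.of_forall fun ζ => ?_)
  simp only
  rw [← Real.exp_nat_mul]
  congr 1
  push_cast
  ring

/-- Test functions vanish at `0`, so they belong to the domain whatever `W` is, and they probe `A`
without boundary terms. -/
theorem graphA_smulState_test {φ : ℝ → ℝ} (hφ : IsTest φ) (e : EuclideanSpace 𝕜 (Fin d)) :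
    GraphA P₀ P₁ W (smulState hφ.memLp e)
      (opState P₀ (smulState hφ.memLp e) + opState P₁ (smulState hφ.deriv.memLp e)) := by
  refine graphA_iff.2 ⟨_, _, isWeakDeriv_smulState hφ.memLp hφ.deriv.memLp hφ.hasDerivAt
    hφ.deriv.contDiff.continuous e, hasBoundaryValue_smulState _ hφ.contDiff.continuous e, ?_, rfl⟩
  rw [hφ.eq_zero_of_nonpos le_rfl, zero_smul]
  exact map_zero (matCLM W)

/-- The function `e^{-ζ} v` realises every boundary value allowed by `W`. -/
theorem exists_graphA_of_act_eq_zero {v : EuclideanSpace 𝕜 (Fin d)} (hv : act W v = 0) :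
    ∃ x x', IsWeakDeriv x x' ∧ HasBoundaryValue x v ∧
      GraphA P₀ P₁ W x (opState P₀ x + opState P₁ x') := by
  have hd : ∀ x : ℝ, HasDerivAt (fun ζ : ℝ => Real.exp (-ζ)) (-Real.exp (-x)) x := fun x => by
    simpa using (hasDerivAt_neg x).exp
  have h1 := isWeakDeriv_smulState memLp_exp_neg memLp_exp_neg.neg hd (by fun_prop) v
  have h2 := hasBoundaryValue_smulState memLp_exp_neg (by fun_prop) v
  rw [neg_zero, Real.exp_zero, one_smul] at h2
  exact ⟨_, _, h1, h2, graphA_iff.2 ⟨_, _, h1, h2, hv, rfl⟩⟩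

theorem inner_smulState {φ : ℝ → ℝ} (hφ : IsTest φ) (e : EuclideanSpace 𝕜 (Fin d))
    (x : State 𝕜 d) :
    inner 𝕜 (smulState hφ.memLp e) x = inner 𝕜 e (∫ ζ, φ ζ • x ζ ∂halfLine) := by
  rw [L2.inner_def, ← integral_inner (hφ.integrable_smul (locallyIntegrable_state x))]
  refine integral_congr_ae ?_
  filter_upwards [coeFn_smulState hφ.memLp e] with ζ h
  rw [h, inner_real_smul_left, inner_real_smul_right]

/-- If `ker W` is its own orthogonal complement for the form of `P₁` and `P₀` is skew-Hermitian,
then `A` is skew-adjoint. -/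
theorem graphA_iff_forall (hP₁ : P₁.IsHermitian) (hP₁inv : IsUnit P₁) (hP₀ : P₀ + P₀ᴴ = 0)
    (hW : ∀ v : EuclideanSpace 𝕜 (Fin d),
      act W v = 0 ↔ ∀ w, act W w = 0 → inner 𝕜 w (act P₁ v) = 0) (x y : State 𝕜 d) :
    GraphA P₀ P₁ W x y ↔
      ∀ u w, GraphA P₀ P₁ W u w → inner 𝕜 w x + inner 𝕜 u y = 0 := by
  constructor
  · intro hxy u w huw
    obtain ⟨x', v, hx, hv, hWv, rfl⟩ := graphA_iff.1 hxy
    obtain ⟨u', v', hu, hv', hWv', rfl⟩ := graphA_iff.1 huw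
    rw [inner_add_inner_eq_boundary hP₁ hx hv hu hv', hP₀, opState_zero, inner_zero_left,
      (hW v).1 hWv v' hWv', sub_zero]
  · intro h
    have hdet : IsUnit P₁.det := (Matrix.isUnit_iff_isUnit_det _).1 hP₁inv
    have hinv : (P₁⁻¹)ᴴ = P₁⁻¹ := by rw [Matrix.conjTranspose_nonsing_inv, hP₁.eq]
    have hx : IsWeakDeriv x (opState P₁⁻¹ (y - opState P₀ x)) := by
      intro φ h1 h2 h3
      have hφ : IsTest φ := ⟨h1, h2, h3⟩
      refine ext_inner_left 𝕜 fun e => ?_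
      -- The factor `P₁⁻¹` cancels the `P₁` in front of the derivative, so the pairing tests `x`
      -- against `φ' e` itself.
      have h4 := h _ _ (graphA_smulState_test hφ (act P₁⁻¹ e))
      have h5 : opState P₁ (smulState hφ.deriv.memLp (act P₁⁻¹ e)) =
          smulState hφ.deriv.memLp e := by
        refine Lp.ext ?_
        filter_upwards [coeFn_opState P₁ (smulState hφ.deriv.memLp (act P₁⁻¹ e)),
          coeFn_smulState hφ.deriv.memLp (act P₁⁻¹ e), coeFn_smulState hφ.deriv.memLp e]
          with ζ h6 h7 h8
        rw [h6, h7, h8, ← matCLM_apply, matCLM_real_smul, matCLM_apply, ← act_mul,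
          Matrix.mul_nonsing_inv _ hdet, act_one]
      have h6 : opState P₀ᴴ x = - opState P₀ x := by
        rw [eq_neg_iff_add_eq_zero, add_comm, ← opState_add, hP₀, opState_zero]
      have h7 : ∀ z : State 𝕜 d, inner 𝕜 (smulState hφ.memLp (act P₁⁻¹ e)) z =
          inner 𝕜 e (∫ ζ, φ ζ • opState P₁⁻¹ z ζ ∂halfLine) := by
        intro z
        rw [inner_smulState hφ, inner_act_left, hinv, hφ.integral_smul_opState, matCLM_apply]
      rw [h5, inner_add_left, inner_opState_left, h6, inner_neg_right, h7,
        inner_smulState hφ.deriv, h7] at h4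
      have h8 : ∫ ζ, φ ζ • opState P₁⁻¹ (y - opState P₀ x) ζ ∂halfLine =
          ∫ ζ, φ ζ • opState P₁⁻¹ y ζ ∂halfLine -
            ∫ ζ, φ ζ • opState P₁⁻¹ (opState P₀ x) ζ ∂halfLine := by
        rw [← integral_sub (hφ.integrable_smul (locallyIntegrable_state _))
          (hφ.integrable_smul (locallyIntegrable_state _)), map_sub]
        refine integral_congr_ae ?_
        filter_upwards [Lp.coeFn_sub (opState P₁⁻¹ y) (opState P₁⁻¹ (opState P₀ x))] with ζ h9
        rw [h9, Pi.sub_apply, smul_sub]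
      rw [h8, inner_neg_right, inner_sub_right]
      linear_combination h4
    obtain ⟨v, hv⟩ := hx.exists_hasBoundaryValue
    have hy : y = opState P₀ x + opState P₁ (opState P₁⁻¹ (y - opState P₀ x)) := by
      rw [← opState_mul, Matrix.mul_nonsing_inv _ hdet, opState_one, add_sub_cancel]
    refine graphA_iff.2 ⟨_, v, hx, hv, (hW v).2 fun w hw => ?_, hy⟩
    -- Now that `x` is known to be weakly differentiable, only the boundary form survives; arbitrary
    -- `w ∈ ker W` places `v` in the orthogonal complement of `ker W`.
    obtain ⟨u, u', hu, hbu, hgu⟩ := exists_graphA_of_act_eq_zero (P₀ := P₀) (P₁ := P₁) hw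
    have h1 := h _ _ hgu
    rw [hy, inner_add_inner_eq_boundary hP₁ hx hv hu hbu, hP₀, opState_zero, inner_zero_left,
      zero_sub, neg_eq_zero] at h1
    exact h1

/-- A vanishing numerical range of `A` forces `Re P₀ = 0` and that `ker W` is isotropic. -/
theorem isotropic_of_re_inner_eq_zero (hP₁ : P₁.IsHermitian)
    (h : ∀ x y, GraphA P₀ P₁ W x y → RCLike.re (inner 𝕜 y x) = 0) :
    P₀ + P₀ᴴ = 0 ∧ ∀ v, act W v = 0 → inner 𝕜 v (act P₁ v) = 0 := by
  have hsum : ∀ x x' v, IsWeakDeriv x x' → HasBoundaryValue x v →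
      GraphA P₀ P₁ W x (opState P₀ x + opState P₁ x') →
      RCLike.re (inner 𝕜 (opState (P₀ + P₀ᴴ) x) x) = RCLike.re (inner 𝕜 v (act P₁ v)) := by
    intro x x' v hx hv hg
    have h1 := congrArg RCLike.re (inner_add_inner_eq_boundary (P₀ := P₀) hP₁ hx hv hx hv)
    have h2 := h _ _ hg
    rw [map_add, map_sub, inner_re_symm (𝕜 := 𝕜) x, h2] at h1
    linarith
  have hherm : (P₀ + P₀ᴴ).IsHermitian := by
    rw [Matrix.IsHermitian, Matrix.conjTranspose_add, Matrix.conjTranspose_conjTranspose, add_comm]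
  -- A Hermitian form takes real values on the diagonal, so its real part decides.
  have him : ∀ (M : Matrix (Fin d) (Fin d) 𝕜), M.IsHermitian → ∀ v : EuclideanSpace 𝕜 (Fin d),
      RCLike.re (inner 𝕜 v (act M v)) = 0 → inner 𝕜 v (act M v) = 0 := by
    intro M hM v hv
    refine RCLike.ext (by rw [hv, map_zero]) ?_
    rw [map_zero, inner_act_right]
    exact hM.im_star_dotProduct_mulVec_self _
  have hP₀ : P₀ + P₀ᴴ = 0 := by
    -- For the constant direction `e'` times `ψ` the boundary term is zero, and the interior term is
    -- `∫ ψ² > 0` times the form at `e'`.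
    obtain ⟨ψ, hψ, hψ1⟩ := exists_isTest_integral_eq_one
    refine eq_zero_of_isHermitian hherm fun e => ?_
    set e' : EuclideanSpace 𝕜 (Fin d) := WithLp.toLp 2 e with he'
    rw [show e = WithLp.ofLp e' from rfl, ← inner_act_right]
    refine him _ hherm _ ?_
    have h1 := hsum _ _ _ (isWeakDeriv_smulState hψ.memLp hψ.deriv.memLp hψ.hasDerivAt
      hψ.deriv.contDiff.continuous e') (hasBoundaryValue_smulState _ hψ.contDiff.continuous e')
      (graphA_smulState_test hψ e')
    rw [hψ.eq_zero_of_nonpos le_rfl, zero_smul, inner_zero_left, map_zero, inner_re_symm (𝕜 := 𝕜),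
      inner_smulState hψ] at h1
    have h2 : ∫ ζ, ψ ζ • opState (P₀ + P₀ᴴ) (smulState hψ.memLp e') ζ ∂halfLine =
        (∫ ζ, ψ ζ * ψ ζ) • act (P₀ + P₀ᴴ) e' := by
      rw [← hψ.integral_smul_smul]
      refine integral_congr_ae ?_
      filter_upwards [coeFn_opState (P₀ + P₀ᴴ) (smulState hψ.memLp e'),
        coeFn_smulState hψ.memLp e'] with ζ h3 h4
      rw [h3, h4, ← matCLM_apply, matCLM_real_smul, matCLM_apply]
    rw [h2, inner_real_smul_right, RCLike.re_ofReal_mul, mul_eq_zero] at h1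
    refine h1.resolve_left (ne_of_gt ?_)
    obtain ⟨x, hx⟩ : ∃ x, ψ x ≠ 0 := by
      by_contra! h0
      simp [h0] at hψ1
    exact (hψ.contDiff.continuous.mul hψ.contDiff.continuous)
      |>.integral_pos_of_hasCompactSupport_nonneg_nonzero hψ.hasCompactSupport.mul_left
        (fun ζ => mul_self_nonneg _) (mul_self_ne_zero.2 hx)
  refine ⟨hP₀, fun v hv => him _ hP₁ _ ?_⟩
  obtain ⟨x, x', hx, hbx, hg⟩ := exists_graphA_of_act_eq_zero (P₀ := P₀) (P₁ := P₁) hv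
  rw [← hsum x x' v hx hbx hg, hP₀, opState_zero, inner_zero_left, map_zero]

end Graph

/-! ### Generation by `Aℋ` in the energy scalar product -/

section Generation

variable {𝕜 : Type*} [RCLike 𝕜] {d k : ℕ} {P₀ P₁ : Matrix (Fin d) (Fin d) 𝕜}
  {W : Matrix (Fin k) (Fin d) 𝕜} {ℋ : ℝ → Matrix (Fin d) (Fin d) 𝕜}

theorem rePart_eq_zero_iff {P : Matrix (Fin d) (Fin d) 𝕜} : rePart P = 0 ↔ P + Pᴴ = 0 := by
  rw [rePart, smul_eq_zero_iff_right (inv_ne_zero two_ne_zero)]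

theorem graphAH_iff {H : State 𝕜 d →L[𝕜] State 𝕜 d}
    (hH : ∀ f, ∀ᵐ ζ ∂halfLine, H f ζ = act (ℋ ζ) (f ζ)) {x y : State 𝕜 d} :
    GraphAH P₀ P₁ W ℋ x y ↔ GraphA P₀ P₁ W (H x) y := by
  constructor
  · rintro ⟨z, hz, hg⟩
    have : H x = z := by
      refine Lp.ext ?_
      filter_upwards [hz, hH x] with ζ h1 h2
      rw [h1, h2]
    rwa [this]
  · exact fun h => ⟨H x, hH x, h⟩

theorem energyNorm_eq {H : State 𝕜 d →L[𝕜] State 𝕜 d}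
    (hH : ∀ f, ∀ᵐ ζ ∂halfLine, H f ζ = act (ℋ ζ) (f ζ)) (x : State 𝕜 d) :
    energyNorm ℋ x = √(RCLike.re (inner 𝕜 x (H x))) := by
  rw [energyNorm, energyInner_eq hH]

/-- Coercivity bounds the standard norm by a multiple of the energy norm. -/
theorem tendsto_zero_of_energyNorm {H : State 𝕜 d →L[𝕜] State 𝕜 d}
    (hH : ∀ f, ∀ᵐ ζ ∂halfLine, H f ζ = act (ℋ ζ) (f ζ)) {c : ℝ} (hc : 0 < c)
    (hcoer : ∀ f, c * ‖f‖ ^ 2 ≤ RCLike.re (inner 𝕜 f (H f))) {α : Type*} {F : Filter α}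
    {f : α → State 𝕜 d} (hf : Tendsto (fun a => energyNorm ℋ (f a)) F (𝓝 0)) :
    Tendsto f F (𝓝 0) := by
  rw [tendsto_zero_iff_norm_tendsto_zero]
  have h1 : Tendsto (fun a => (√c)⁻¹ * energyNorm ℋ (f a)) F (𝓝 0) := by
    simpa using hf.const_mul (√c)⁻¹
  refine squeeze_zero (fun _ => norm_nonneg _) (fun a => ?_) h1
  rw [le_inv_mul_iff₀ (Real.sqrt_pos.2 hc), energyNorm_eq hH]
  refine Real.le_sqrt_of_sq_le ?_
  rw [mul_pow, Real.sq_sqrt hc.le]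
  exact hcoer _

/-- If `A` is skew-adjoint then `Aℋ` generates a unitary group for the energy scalar product. -/
theorem generatesUnitaryGroup_of_skewAdjoint {H K : State 𝕜 d →L[𝕜] State 𝕜 d}
    (hH : ∀ f, ∀ᵐ ζ ∂halfLine, H f ζ = act (ℋ ζ) (f ζ)) (hHK : ∀ f, H (K f) = f)
    (hsymm : ∀ f g, inner 𝕜 (H f) g = inner 𝕜 f (H g)) {c : ℝ} (hc : 0 < c)
    (hcoer : ∀ f, c * ‖f‖ ^ 2 ≤ RCLike.re (inner 𝕜 f (H f)))
    (hA : ∀ x y, GraphA P₀ P₁ W x y ↔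
      ∀ u w, GraphA P₀ P₁ W u w → inner 𝕜 w x + inner 𝕜 u y = 0) :
    GeneratesUnitaryGroup ℋ (GraphAH P₀ P₁ W ℋ) := by
  have hAH : ∀ x y, GraphAH P₀ P₁ W ℋ x y ↔
      ∀ u v, GraphAH P₀ P₁ W ℋ u v → inner 𝕜 v (H x) + inner 𝕜 u (H y) = 0 := by
    intro x y
    rw [graphAH_iff hH, hA]
    refine ⟨fun h u v huv => ?_, fun h u v huv => ?_⟩
    · rw [← hsymm u y]
      exact h _ _ ((graphAH_iff hH).1 huv)
    · have h1 := h (K u) v ((graphAH_iff hH).2 (by rwa [hHK]))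
      rwa [← hsymm (K u) y, hHK] at h1
  have h0 : ∀ y, GraphAH P₀ P₁ W ℋ 0 y → y = 0 := fun y hy =>
    hy.unique ((hAH 0 0).2 fun u v _ => by simp)
  obtain ⟨T, hT0, hTadd, hTcont, hTinner, hTgen⟩ :=
    exists_unitary_group_of_skewAdjoint H hsymm hc hcoer hAH h0
  refine ⟨T, ⟨hT0, hTadd, fun x => ?_, fun t x y => ?_⟩, fun x y => ?_⟩
  · simpa only [energyNorm_eq hH] using hTcont x
  · rw [energyInner_eq hH, energyInner_eq hH, hTinner]
  · simpa only [energyNorm_eq hH] using hTgen x y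

/-- The orbit of `K x` has derivative `y` at `0`. Differentiating its conserved energy gives `⟨y, H
K x⟩ + ⟨H K x, y⟩ = 0`, and `H K x = x`. -/
theorem re_inner_eq_zero_of_generatesUnitaryGroup {H K : State 𝕜 d →L[𝕜] State 𝕜 d}
    (hH : ∀ f, ∀ᵐ ζ ∂halfLine, H f ζ = act (ℋ ζ) (f ζ)) (hHK : ∀ f, H (K f) = f)
    (hsymm : ∀ f g, inner 𝕜 (H f) g = inner 𝕜 f (H g)) {c : ℝ} (hc : 0 < c)
    (hcoer : ∀ f, c * ‖f‖ ^ 2 ≤ RCLike.re (inner 𝕜 f (H f)))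
    (hgen : GeneratesUnitaryGroup ℋ (GraphAH P₀ P₁ W ℋ)) {x y : State 𝕜 d}
    (hxy : GraphA P₀ P₁ W x y) : RCLike.re (inner 𝕜 y x) = 0 := by
  obtain ⟨T, hT, hTgen⟩ := hgen
  have h1 := tendsto_zero_of_energyNorm hH hc hcoer
    ((hTgen (K x) y).1 ((graphAH_iff hH).2 (by rwa [hHK])))
  have h2 := tendsto_zero_of_energyNorm hH hc hcoer (hT.strong_cont (K x))
  rw [tendsto_sub_nhds_zero_iff] at h1 h2
  have h3 := inner_add_inner_eq_zero_of_tendsto H h2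
    (fun t => by rw [← energyInner_eq hH, hT.unitary, energyInner_eq hH]) h1 h1
  rw [← hsymm (K x) y, hHK] at h3
  have h4 := congrArg RCLike.re h3
  rw [map_add, inner_re_symm (𝕜 := 𝕜) x, map_zero] at h4
  linarith

end Generation

end PortHamiltonian

end

/-! ### The equivalence -/

open scoped ComplexOrder in
open PortHamiltonian in
theorem theorem2p6 {𝕜 : Type*} [RCLike 𝕜] {d k n₁ n₂ : ℕ}
    (P₀ P₁ : Matrix (Fin d) (Fin d) 𝕜) (hP₁ : P₁.IsHermitian) (hP₁inv : IsUnit P₁)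
    (hn₁ : n₁ = numPosEigenvalues hP₁) (hn₂ : n₂ = numNegEigenvalues hP₁)
    (S : Matrix (Fin n₁ ⊕ Fin n₂) (Fin d) 𝕜) (l : Fin n₁ → ℝ) (θ : Fin n₂ → ℝ)
    (hS : IsDiagonalization P₁ S l θ)
    (ℋ : ℝ → Matrix (Fin d) (Fin d) 𝕜)
    (hℋpos : ∀ᵐ ζ ∂halfLine, (ℋ ζ).PosDef)
    (hℋ : ∀ i j, MemLp (fun ζ => ℋ ζ i j) ⊤ halfLine)
    (hℋinv : ∀ i j, MemLp (fun ζ => (ℋ ζ)⁻¹ i j) ⊤ halfLine)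
    (W : Matrix (Fin k) (Fin d) 𝕜) (hk : k ≤ min n₁ n₂) (hW : W.rank = k) :
    List.TFAE [
      GeneratesUnitaryGroup ℋ (GraphAH P₀ P₁ W ℋ),
      ∀ x y, GraphA P₀ P₁ W x y → RCLike.re (inner 𝕜 y x) = 0,
      rePart P₀ = 0 ∧ ∀ y : Fin d → 𝕜, W *ᵥ y = 0 → star y ⬝ᵥ (P₁ *ᵥ y) = 0,
      ∃ (h₁ : n₁ = k) (h₂ : n₁ = n₂), rePart P₀ = 0 ∧
        ∃ U₁ U₂ : Matrix (Fin n₁) (Fin n₁) 𝕜, IsUnit U₁ ∧ IsUnit U₂ ∧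
          W.submatrix (Fin.cast h₁) id =
            Matrix.fromCols U₁ (U₂.submatrix id (Fin.cast h₂.symm)) * S ∧
          realDiag 𝕜 l +
            U₁ᴴ * (U₂⁻¹)ᴴ * realDiag 𝕜 (fun i => θ (Fin.cast h₂ i)) * U₂⁻¹ * U₁ = 0] := by
  obtain ⟨H, K, hH, hHK, hsymm, c, hc, hcoer⟩ := exists_energyOperator hℋpos hℋ hℋinv
  tfae_have 1 → 2 := fun h x y hxy =>
    re_inner_eq_zero_of_generatesUnitaryGroup hH hHK hsymm hc hcoer h hxy
  tfae_have 2 → 3 := by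
    intro h
    obtain ⟨h1, h2⟩ := isotropic_of_re_inner_eq_zero hP₁ h
    refine ⟨rePart_eq_zero_iff.2 h1, fun y hy => ?_⟩
    have h3 := h2 (WithLp.toLp 2 y) (act_eq_zero_iff.2 hy)
    rwa [inner_act_right] at h3
  tfae_have 3 → 4 := by
    rintro ⟨h1, h2⟩
    obtain ⟨rfl, rfl⟩ := hS.dims_eq hk hW h2
    obtain ⟨U₁, U₂, hU₁, hU₂, hWU, hU⟩ := hS.exists_blocks h2
    exact ⟨rfl, rfl, h1, U₁, U₂, hU₁, hU₂, hWU, hU⟩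
  tfae_have 4 → 1 := by
    rintro ⟨rfl, rfl, h1, U₁, U₂, hU₁, hU₂, hWU, hU⟩
    -- Once the dimensions are identified, the casts in statement 4 are definitionally trivial.
    have hWU' : W = Matrix.fromCols U₁ U₂ * S := hWU
    refine generatesUnitaryGroup_of_skewAdjoint hH hHK hsymm hc hcoer
      (graphA_iff_forall hP₁ hP₁inv (rePart_eq_zero_iff.1 h1) fun v => ?_)
    rw [act_eq_zero_iff, hS.mulVec_eq_zero_iff_forall hWU' hU₁ hU₂ hU]
    refine ⟨fun h w hw => ?_, fun h z hz => ?_⟩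
    · rw [inner_act_right]
      exact h _ (act_eq_zero_iff.1 hw)
    · have h2 := h (WithLp.toLp 2 z) (act_eq_zero_iff.2 hz)
      rwa [inner_act_right] at h2
  tfae_finish
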